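/- **Conventions.** For a groupoid $\mathcal G$ with unit space $\mathcal G^0$ (units identified with objects), $s,r:\mathcal G\to\mathcal G^0$ are the source and range maps, $gh$ is defined when $s(g)=r(h)$, $x\mathcal G=r^{-1}(x)$, and for $S\subseteq\mathcal G$, $xS=S\cap x\mathcal G$. A *discrete p.m.p. groupoid* is a groupoid such that $\mathcal G$ and $\mathcal G^0$ are standard Borel spaces, $s,r$ are Borel and countable-to-one, composition and inversion are Borel, with a Borel probability measure $\mu$ on $\mathcal G^0$ such that $\int c^r_x\,d\mu(x)=\int c^s_x\,d\mu(x)$, where $c_x^r,c_x^s$ are the counting measures on $r^{-1}(x)$, $s^{-1}(x)$. It is *principal* if $g\mapsto(r(g),s(g))$ is injective. For a standard probability space $(Y,\nu)$ let $Y^{\otimes\mathcal G}=\bigsqcup_{x\in\mathcal G^0}Y^{x\mathcal G}$, with the $\sigma$-algebra generated by the projection $p$ to $\mathcal G^0$ and the maps $y\mapsto y_{\sigma(p(y))}$, $\sigma$ a Borel section of $r$, and with the measure $\nu^{\otimes\mathcal G}=\int\nu^{x\mathcal G}\,d\mu(x)$. For $g\in\mathcal G$ and $y\in Y^{s(g)\mathcal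 G}$ let $g.y\in Y^{r(g)\mathcal G}$ be given by $(g.y)_w=y_{g^{-1}w}$. A *fiberwise isomorphism of measure spaces* $\phi:(Y^{\otimes\mathcal G},\nu^{\otimes\mathcal G})\to(Z^{\otimes\mathcal G},\eta^{\otimes\mathcal G})$ is a Borel map with $\phi(Y^{x\mathcal G})\subseteq Z^{x\mathcal G}$ for all $x$, injective on a conull set, with $\phi_*\nu^{x\mathcal G}=\eta^{x\mathcal G}$ for almost every $x$. Its inverse $\phi^{-1}$ is a fiber-preserving Borel map, determined up to a null set. For a discrete p.m.p. groupoid $\mathcal K$ and a countable set $I$, $\bigoplus_I\mathcal K$ is the groupoid of all $k\in\mathcal K^I$ with $k_i$ a unit for all but finitely many $i$, with coordinatewise operations and with the product measure on its unit space $(\mathcal K^0)^I$. Let $\mathcal B,\mathcal C$ be principal discrete p.m.p. groupoids with measures $\nu,\eta$ on their unit spaces. A fiber-preserving Borel map $\phi:(\mathcal B^0)^{\otimes\mathcal G}\to(\mathcal C^0)^{\otimes\mathcal G}$ is *cofinitely $\mathcal G$-equivariant* (with respect to $\mathcal B$ and $\mathcal C$) if for each $g\in\mathcal G$, for almost every $b\in\bigoplus_{s(g)\mathcal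 G}\mathcal B$ (that is, for $\nu^{s(g)\mathcal G}$-almost every unit $a$ and every $b$ with $s(b)=a$) there is $c\in\bigoplus_{s(g)\mathcal G}\mathcal C$ with $s(c)=\phi(s(b))$ and $r(c)=g^{-1}.\phi(g.r(b))$. A fiberwise isomorphism $\phi$ is *bi-cofinitely $\mathcal G$-equivariant* if $\phi$ and (some version of) $\phi^{-1}$ are both cofinitely $\mathcal G$-equivariant, where the latter is with respect to $\mathcal C$ and $\mathcal B$. **Theorem.** Let $(\mathcal G,\mu)$ be a discrete p.m.p. groupoid and let $\mathcal H\le\mathcal G$ be a Borel subgroupoid with $\mathcal H^0=\mathcal G^0$ (equipped with the same measure $\mu$). Assume that there is a Borel set $\Sigma\subseteq\mathcal G$ containing exactly one element of each left coset $g\mathcal H=\{gh: h\in\mathcal H,\ r(h)=s(g)\}$, $g\in\mathcal G$, and such that $|g(s(g)\Sigma)\,\triangle\,r(g)\Sigma|<\infty$ for all $g\in\mathcal G$. Let $\mathcal B$ and $\mathcal C$ be principal discrete p.m.p. groupoids with measures $\nu$ and $\eta$ on their unit spaces. If there exists a bi-cofinitely $\mathcal H$-equivariant fiberwise isomorphism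 of measure spaces $\phi_{\mathcal H}:((\mathcal B^0)^{\otimes\mathcal H},\nu^{\otimes\mathcal H})\to((\mathcal C^0)^{\otimes\mathcal H},\eta^{\otimes\mathcal H})$ with respect to $\mathcal B$ and $\mathcal C$, then there exists a bi-cofinitely $\mathcal G$-equivariant fiberwise isomorphism of measure spaces $\phi:((\mathcal B^0)^{\otimes\mathcal G},\nu^{\otimes\mathcal G})\to((\mathcal C^0)^{\otimes\mathcal G},\eta^{\otimes\mathcal G})$ with respect to $\mathcal B$ and $\mathcal C$. -/

import Mathlib

open CategoryTheory MeasureTheory Set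
open scoped ENNReal

universe v u v' u' v'' u''

noncomputable section

namespace PMPGroupoid

/-! Groupoids are Mathlib's groupoids: `X` is the unit space (units are identified with objects),
`Quiver.Total X` is the set of all arrows, an arrow `g : a ⟶ b` has source `a` and range `b`, and
the product written `g h` (defined when the source of `g` is the range of `h`) is `h ≫ g`.
`Quiver.Costar x` is the set `x𝒢` of arrows with range `x`. -/

/-- The set of composable pairs of arrows. -/
structure Composable (X : Type u) [Groupoid.{v} X] where
  (x y z : X)
  fst : x ⟶ y
  snd : y ⟶ z

/-- The pair of arrows underlying a composable pair. -/
def Composable.toPair {X : Type u} [Groupoid.{v} X] (p : Composable X) :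
    Quiver.Total X × Quiver.Total X :=
  (⟨p.x, p.y, p.fst⟩, ⟨p.y, p.z, p.snd⟩)

/-- Composable pairs form a subset of the product of the space of arrows with itself. -/
instance (X : Type u) [Groupoid.{v} X] [MeasurableSpace (Quiver.Total X)] :
    MeasurableSpace (Composable X) :=
  MeasurableSpace.comap Composable.toPair inferInstance

/-- The arrow with range `x` given by an element of `x𝒢`. -/
def arrowOf {X : Type u} [Groupoid.{v} X] {x : X} (w : Quiver.Costar x) : Quiver.Total X :=
  ⟨w.1, x, w.2⟩

/-- Discrete Borel groupoids: the arrows and the units form standard Borel spaces, the source and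
range maps are Borel and countable-to-one, and composition, inversion and `x ↦ e_x` are Borel. -/
structure IsDiscreteBorel (X : Type u) [Groupoid.{v} X] [MeasurableSpace X]
    [MeasurableSpace (Quiver.Total X)] : Prop where
  standardBorel_units : StandardBorelSpace X
  standardBorel_arrows : StandardBorelSpace (Quiver.Total X)
  measurable_source : Measurable (fun g : Quiver.Total X => g.left)
  measurable_range : Measurable (fun g : Quiver.Total X => g.right)
  countable_source : ∀ x : X, {g : Quiver.Total X | g.left = x}.Countable
  countable_range : ∀ x : X, {g : Quiver.Total X | g.right = x}.Countable
  measurable_id : Measurable (fun x : X => (⟨x, x, 𝟙 x⟩ : Quiver.Total X))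
  measurable_inv :
    Measurable (fun g : Quiver.Total X => (⟨g.right, g.left, inv g.hom⟩ : Quiver.Total X))
  measurable_comp :
    Measurable (fun p : Composable X => (⟨p.x, p.z, p.fst ≫ p.snd⟩ : Quiver.Total X))

/-- Discrete p.m.p. groupoids: a discrete Borel groupoid with a Borel probability measure `μ` on
the unit space such that integrating over `μ` the counting measures on the fibers of the range map
and of the source map gives the same measure on the space of arrows. -/
structure IsDiscretePMP {X : Type u} [Groupoid.{v} X] [MeasurableSpace X]
    [MeasurableSpace (Quiver.Total X)] (μ : Measure X) : Prop extends IsDiscreteBorel X where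
  isProbabilityMeasure : IsProbabilityMeasure μ
  lintegral_count_eq : ∀ A : Set (Quiver.Total X), MeasurableSet A →
    ∫⁻ x, Measure.count (A ∩ {g | g.right = x}) ∂μ = ∫⁻ x, Measure.count (A ∩ {g | g.left = x}) ∂μ

/-! ### Subgroupoids and left cosets -/

/-- The inclusion of the arrows of a subgroupoid `H` (Mathlib regards `H` as a groupoid on the set
`H.objs` of its objects) into the arrows of the ambient groupoid. -/
def inclArrow {X : Type u} [Groupoid.{v} X] (H : Subgroupoid X) (h : Quiver.Total H.objs) :
    Quiver.Total X :=
  ⟨h.left.1, h.right.1, h.hom.1⟩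

/-- The arrows of a subgroupoid carry the subspace Borel structure. -/
instance {X : Type u} [Groupoid.{v} X] [MeasurableSpace (Quiver.Total X)] (H : Subgroupoid X) :
    MeasurableSpace (Quiver.Total H.objs) :=
  MeasurableSpace.comap (inclArrow H) inferInstance

/-- The set `xS` of the arrows in `S` with range `x`. -/
def fiberSet {X : Type u} [Groupoid.{v} X] (S : Set (Quiver.Total X)) (x : X) :
    Set (Quiver.Costar x) :=
  {w | arrowOf w ∈ S}

/-- The left coset `gH = {gh : h ∈ H, r(h) = s(g)}` of an arrow `g` with range `x`. -/
def leftCoset {X : Type u} [Groupoid.{v} X] (H : Subgroupoid X) {x : X} (g : Quiver.Costar x) :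
    Set (Quiver.Costar x) :=
  {w | ∃ h ∈ H.arrows w.1 g.1, w.2 = h ≫ g.2}

/-- `S` contains exactly one element of each left coset `gH`. -/
def IsLeftCosetReps {X : Type u} [Groupoid.{v} X] (H : Subgroupoid X)
    (S : Set (Quiver.Total X)) : Prop :=
  ∀ (x : X) (g : Quiver.Costar x), ∃! w : Quiver.Costar x, w ∈ fiberSet S x ∧ w ∈ leftCoset H g

/-- Left translation `w ↦ gw` from `s(g)𝒢` to `r(g)𝒢`. -/
def leftTranslate {X : Type u} [Groupoid.{v} X] {a b : X} (g : a ⟶ b) (w : Quiver.Costar a) :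
    Quiver.Costar b :=
  ⟨w.1, w.2 ≫ g⟩

/-! ### The bundle of product spaces over the unit space -/

/-- The space `Y^{⊗𝒢}`, the disjoint union over units `x` of the powers `Y^{x𝒢}`. -/
structure TensorPower (X : Type u) [Groupoid.{v} X] (Y : Type u') where
  base : X
  val : Quiver.Costar base → Y

/-- The σ-algebra on `Y^{⊗𝒢}` generated by the projection `p` to the unit space and the maps
`y ↦ y_{σ(p(y))}`, where `σ` varies over all Borel sections of the range map. -/
instance (X : Type u) [Groupoid.{v} X] (Y : Type u') [MeasurableSpace X]
    [MeasurableSpace (Quiver.Total X)] [MeasurableSpace Y] : MeasurableSpace (TensorPower X Y) :=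
  MeasurableSpace.comap TensorPower.base inferInstance ⊔
    ⨆ (σ : ∀ x : X, Quiver.Costar x) (_ : Measurable fun x => arrowOf (σ x)),
      MeasurableSpace.comap (fun y : TensorPower X Y => y.val (σ y.base)) inferInstance

/-- The product measure `ν^{x𝒢}` on `Y^{x𝒢}`. -/
def fiberMeasure {X : Type u} [Groupoid.{v} X] {Y : Type u'} [MeasurableSpace Y]
    (ν : Measure Y) (x : X) : Measure (Quiver.Costar x → Y) :=
  Measure.infinitePi fun _ => ν

/-- The measure `ν^{⊗𝒢} = ∫ ν^{x𝒢} dμ(x)` on `Y^{⊗𝒢}`. -/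
def tensorMeasure {X : Type u} [Groupoid.{v} X] {Y : Type u'} [MeasurableSpace X]
    [MeasurableSpace (Quiver.Total X)] [MeasurableSpace Y] (μ : Measure X) (ν : Measure Y) :
    Measure (TensorPower X Y) :=
  μ.bind fun x => (fiberMeasure ν x).map (TensorPower.mk x)

/-- The shift `(g.k)_w = k_{g⁻¹w}` from `Y^{s(g)𝒢}` to `Y^{r(g)𝒢}`. -/
def shift {X : Type u} [Groupoid.{v} X] {Y : Type u'} {a b : X} (g : a ⟶ b)
    (k : Quiver.Costar a → Y) : Quiver.Costar b → Y :=
  fun w => k (leftTranslate (inv g) w)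

/-- The map `Y^{⊗𝒢} → Z^{⊗𝒢}` given by a family of maps `φ x : Y^{x𝒢} → Z^{x𝒢}`. -/
def totalMap {X : Type u} [Groupoid.{v} X] {Y : Type u'} {Z : Type u''}
    (φ : ∀ x : X, (Quiver.Costar x → Y) → (Quiver.Costar x → Z)) (y : TensorPower X Y) :
    TensorPower X Z :=
  ⟨y.base, φ y.base y.val⟩

/-- A fiberwise isomorphism of measure spaces from `(Y^{⊗𝒢}, ν^{⊗𝒢})` to `(Z^{⊗𝒢}, η^{⊗𝒢})`: a
fiber-preserving Borel map which is injective on a conull set and pushes `ν^{x𝒢}` forward to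
`η^{x𝒢}` for almost every unit `x`. -/
structure IsFiberwiseIso {X : Type u} [Groupoid.{v} X] {Y : Type u'} {Z : Type u''}
    [MeasurableSpace X] [MeasurableSpace (Quiver.Total X)] [MeasurableSpace Y] [MeasurableSpace Z]
    (μ : Measure X) (ν : Measure Y) (η : Measure Z)
    (φ : ∀ x : X, (Quiver.Costar x → Y) → (Quiver.Costar x → Z)) : Prop where
  measurable : Measurable (totalMap φ)
  injOn : ∃ D ∈ ae (tensorMeasure μ ν), InjOn (totalMap φ) D
  map_eq : ∀ᵐ x ∂μ, (fiberMeasure ν x).map (φ x) = fiberMeasure η x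

/-- `ψ` is a version of the inverse `φ⁻¹`: a fiber-preserving Borel map with `ψ ∘ φ = id` and
`φ ∘ ψ = id` almost everywhere. (The inverse of a fiberwise isomorphism is determined only up to
a null set.) -/
structure IsAEInverse {X : Type u} [Groupoid.{v} X] {Y : Type u'} {Z : Type u''}
    [MeasurableSpace X] [MeasurableSpace (Quiver.Total X)] [MeasurableSpace Y] [MeasurableSpace Z]
    (μ : Measure X) (ν : Measure Y) (η : Measure Z)
    (φ : ∀ x : X, (Quiver.Costar x → Y) → (Quiver.Costar x → Z))
    (ψ : ∀ x : X, (Quiver.Costar x → Z) → (Quiver.Costar x → Y)) : Prop where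
  measurable : Measurable (totalMap ψ)
  left_inv : ∀ᵐ y ∂(tensorMeasure μ ν), totalMap ψ (totalMap φ y) = y
  right_inv : ∀ᵐ z ∂(tensorMeasure μ η), totalMap φ (totalMap ψ z) = z

/-! ### Direct sums and cofinite equivariance -/

/-- The arrow `k` is a unit. -/
def IsUnitArrow {Y : Type u} [Groupoid.{v} Y] {a b : Y} (k : a ⟶ b) : Prop :=
  ∃ h : a = b, k = eqToHom h

/-- The elements of the direct sum groupoid `⨁_I Y` with source `a` and range `b`, where `a` and
`b` are units of it, that is, elements of the power of the unit space: families of arrows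
`k i : a i ⟶ b i` all but finitely many of which are units. -/
structure DirectSumHom {I : Type u'} {Y : Type u} [Groupoid.{v} Y] (a b : I → Y) where
  coord : ∀ i, a i ⟶ b i
  finite : {i | ¬ IsUnitArrow (coord i)}.Finite

/-- Cofinite equivariance with respect to `Y` and `Z`: for each arrow `g : p ⟶ q`, for almost every
`t` in the direct sum of copies of `Y` over `p𝒢`, there is an element of the direct sum of copies
of `Z` over `p𝒢` with source `φ(s(t))` and range `g⁻¹.φ(g.r(t))`. The measure on the direct sum
is the integral over `ν^{p𝒢}` of the counting measures on the (countable) fibers of the source map,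
so "for almost every `t`" means: for almost every `a`, for all `t` with source `a`. -/
def IsCofinitelyEquivariant {X : Type u} [Groupoid.{v} X] {Y : Type u'} [Groupoid.{v'} Y]
    {Z : Type u''} [Groupoid.{v''} Z] [MeasurableSpace Y] (ν : Measure Y)
    (φ : ∀ x : X, (Quiver.Costar x → Y) → (Quiver.Costar x → Z)) : Prop :=
  ∀ ⦃p q : X⦄ (g : p ⟶ q), ∀ᵐ a ∂(fiberMeasure ν p), ∀ (b : Quiver.Costar p → Y)
    (_ : DirectSumHom a b), Nonempty (DirectSumHom (φ p a) (shift (inv g) (φ q (shift g b))))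

/-- `φ` is a fiberwise isomorphism from `(Y^{⊗𝒢}, ν^{⊗𝒢})` to `(Z^{⊗𝒢}, η^{⊗𝒢})` that is
bi-cofinitely equivariant: both `φ` and `φ⁻¹` are cofinitely equivariant. -/
structure IsBiCofiniteIso {X : Type u} [Groupoid.{v} X] {Y : Type u'} [Groupoid.{v'} Y]
    {Z : Type u''} [Groupoid.{v''} Z]
    [MeasurableSpace X] [MeasurableSpace (Quiver.Total X)] [MeasurableSpace Y] [MeasurableSpace Z]
    (μ : Measure X) (ν : Measure Y) (η : Measure Z)
    (φ : ∀ x : X, (Quiver.Costar x → Y) → (Quiver.Costar x → Z)) : Prop where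
  isFiberwiseIso : IsFiberwiseIso μ ν η φ
  cofinite : IsCofinitelyEquivariant ν φ
  cofinite_inv : ∃ ψ : ∀ x : X, (Quiver.Costar x → Z) → (Quiver.Costar x → Y),
    IsAEInverse μ ν η φ ψ ∧ IsCofinitelyEquivariant η ψ

end PMPGroupoid

end

/-! Each fiber x𝒢 splits into the left cosets σℋ, σ ∈ xΣ, and h ↦ σh identifies s(σ)ℋ with σℋ. So
(ℬ⁰)^{x𝒢} is the product over σ ∈ xΣ of the spaces (ℬ⁰)^{s(σ)ℋ}, and φ is taken to be the product of
the corresponding maps φ_ℋ (`cosetwise`). It preserves the product measures because its factors do,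
and the same construction applied to φ_ℋ⁻¹ inverts it. Invariance of μ ensures that for almost every
x no source s(σ) lies in the null set of bad units (`IsDiscretePMP.ae_forall_costar`).

For cofinite equivariance (`isCofinitelyEquivariant_cosetwise`) write gσ = τk with τ ∈ Σ and k ∈ ℋ.
On the coset σℋ the arrow g acts as k does, so cofinite equivariance of φ_ℋ under k gives arrows of
𝒞 in all coordinates of that coset, all but finitely many of them units. If gσ ∈ Σ and the two given
points agree on σℋ, there is no error on this coset at all. Only finitely many σ ∈ s(g)Σ have gσ ∉
Σ, and points joined by an arrow of the direct sum differ on finitely many cosets, so the total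
error is finite.

Measurability rests on the Lusin–Novikov theorem (`exists_iUnion_injOn`), by which countably many
Borel sections of r exhaust 𝒢. If a continuous f is not injective on each piece of a countable Borel
cover, removing a suitable countable union of such pieces leaves a nonempty set in which finite
configurations inside a fiber can always be split (`exists_nonempty_splits`). A Cantor scheme of
splittings then produces an uncountable fiber (`Splits.exists_uncountable_fiber`). -/

noncomputable section

namespace PMPGroupoid

open Filter Topology

/-! ### The Lusin–Novikov theorem -/

section LusinNovikov

variable {α : Type*} {β : Type*}

/-- The set `A` is covered by countably many Borel sets on each of which `f` is injective. -/
def CountablyInjOn [MeasurableSpace α] (f : α → β) (A : Set α) : Prop :=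
  ∃ B : ℕ → Set α, (∀ n, MeasurableSet (B n)) ∧ (∀ n, InjOn f (B n)) ∧ A ⊆ ⋃ n, B n

lemma CountablyInjOn.of_injOn [MeasurableSpace α] {f : α → β} {A : Set α}
    (hA : MeasurableSet A) (h : InjOn f A) : CountablyInjOn f A :=
  ⟨fun _ => A, fun _ => hA, fun _ => h, subset_iUnion (fun _ : ℕ => A) 0⟩

lemma CountablyInjOn.iUnion [MeasurableSpace α] {ι : Type*} [Countable ι] {f : α → β}
    {A : ι → Set α} (h : ∀ i, CountablyInjOn f (A i)) : CountablyInjOn f (⋃ i, A i) := by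
  choose B h1 h2 h3 using h
  cases isEmpty_or_nonempty ι with
  | inl _ => exact ⟨fun _ => ∅, by simp, by simp, by simp⟩
  | inr _ =>
    obtain ⟨e, he⟩ := exists_surjective_nat (ι × ℕ)
    refine ⟨fun n => B (e n).1 (e n).2, fun n => h1 _ _, fun n => h2 _ _, ?_⟩
    refine iUnion_subset fun i x hx => ?_
    obtain ⟨m, hm⟩ := mem_iUnion.1 (h3 i hx)
    obtain ⟨n, hn⟩ := he (i, m)
    exact mem_iUnion.2 ⟨n, by simpa [hn] using hm⟩

/-- An analytic set on which `f` is injective is contained in such a Borel set. -/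
lemma exists_measurableSet_superset_injOn [TopologicalSpace α] [PolishSpace α]
    [MeasurableSpace α] [BorelSpace α] [TopologicalSpace β] [T2Space β] [MeasurableSpace β]
    [OpensMeasurableSpace β] {f : α → β} (hf : Continuous f) (hfm : Measurable f)
    {A : Set α} (hA : AnalyticSet A) (hinj : InjOn f A) :
    ∃ B, MeasurableSet B ∧ A ⊆ B ∧ InjOn f B := by
  classical
  let b := TopologicalSpace.countableBasis α
  have hbo : ∀ U : b, IsOpen U.1 := fun U => TopologicalSpace.isOpen_of_mem_countableBasis U.2
  have hana : ∀ U : b, AnalyticSet (f '' (A ∩ U.1)) := by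
    intro U
    have : AnalyticSet (A ∩ U.1) := by
      rw [inter_eq_iInter]
      exact AnalyticSet.iInter fun i => by
        cases i
        · exact (hbo U).measurableSet.analyticSet
        · exact hA
    exact this.image_of_continuous hf
  -- Injectivity on `A` makes the analytic images of the two disjoint pieces of `A` disjoint, so
  -- Lusin separation applies.
  have hsep : ∀ p : {p : b × b // Disjoint p.1.1 p.2.1},
      ∃ W, f '' (A ∩ p.1.1.1) ⊆ W ∧ Disjoint (f '' (A ∩ p.1.2.1)) W ∧ MeasurableSet W := by
    intro p
    refine (hana p.1.1).measurablySeparable (hana p.1.2) ?_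
    rw [Set.disjoint_left]
    rintro _ ⟨x, ⟨hxA, hx⟩, rfl⟩ ⟨y, ⟨hyA, hy⟩, hxy⟩
    have := hinj hyA hxA hxy
    subst this
    exact Set.disjoint_left.1 p.2 hx hy
  choose W hW1 hW2 hW3 using hsep
  have : Countable b := (TopologicalSpace.countable_countableBasis α).to_subtype
  -- Points of this set obey every separation: two distinct ones lie in disjoint basic open sets,
  -- hence have images on opposite sides of some `W p`.
  refine ⟨⋂ p, (p.1.1.1ᶜ ∪ f ⁻¹' (W p)) ∩ (p.1.2.1ᶜ ∪ f ⁻¹' (W p)ᶜ), ?_, ?_, ?_⟩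
  · refine MeasurableSet.iInter fun p => ?_
    exact ((hbo _).measurableSet.compl.union (hfm (hW3 p))).inter
      ((hbo _).measurableSet.compl.union (hfm (hW3 p).compl))
  · intro x hx
    refine mem_iInter.2 fun p => ⟨?_, ?_⟩
    · by_cases h : x ∈ p.1.1.1
      · exact Or.inr (hW1 p ⟨x, ⟨hx, h⟩, rfl⟩)
      · exact Or.inl h
    · by_cases h : x ∈ p.1.2.1
      · exact Or.inr (Set.disjoint_left.1 (hW2 p) ⟨x, ⟨hx, h⟩, rfl⟩)
      · exact Or.inl h
  · intro x hx y hy hxy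
    by_contra hne
    obtain ⟨u, v, hu, hv, hxu, hyv, huv⟩ := t2_separation hne
    have hB := TopologicalSpace.isBasis_countableBasis α
    obtain ⟨u', hu', hxu', huu'⟩ := hB.exists_subset_of_mem_open hxu hu
    obtain ⟨v', hv', hyv', hvv'⟩ := hB.exists_subset_of_mem_open hyv hv
    let p : {p : b × b // Disjoint p.1.1 p.2.1} :=
      ⟨(⟨u', hu'⟩, ⟨v', hv'⟩), huv.mono huu' hvv'⟩
    have h1 := (mem_iInter.1 hx p).1.resolve_left (fun h => h hxu')
    have h2 := (mem_iInter.1 hy p).2.resolve_left (fun h => h hyv')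
    rw [mem_preimage, hxy] at h1
    exact h2 h1

/-- The points `g j` lie in `D` and in the sets `U j`, and in one fiber of `f`. -/
def Realizes {ι : Type*} (f : α → β) (D : Set α) (U : ι → Set α) (g : ι → α) : Prop :=
  (∀ j, g j ∈ U j ∩ D) ∧ ∀ j j', f (g j) = f (g j')

/-- Whenever finitely many open sets contain points of `D` in a common fiber, such points can be
chosen in two ways within one fiber so that a given one of them is moved. -/
def Splits [TopologicalSpace α] (f : α → β) (D : Set α) : Prop :=
  ∀ (k : ℕ) (U : Fin k → Set α), (∀ j, IsOpen (U j)) → (∃ g, Realizes f D U g) →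
    ∀ i, ∃ p q, Realizes f D U p ∧ Realizes f D U q ∧ p i ≠ q i ∧ f (p i) = f (q i)

lemma Realizes.mono {ι : Type*} {f : α → β} {D D' : Set α} {U U' : ι → Set α} {g : ι → α}
    (h : Realizes f D U g) (hD : D ⊆ D') (hU : ∀ j, U j ⊆ U' j) : Realizes f D' U' g :=
  ⟨fun j => ⟨hU j (h.1 j).1, hD (h.1 j).2⟩, h.2⟩

/-- If the space is not covered by countably many Borel sets on which `f` is injective, then some
nonempty set splits. -/
lemma exists_nonempty_splits [TopologicalSpace α] [PolishSpace α]
    [MeasurableSpace α] [BorelSpace α] [TopologicalSpace β] [T2Space β] [SecondCountableTopology β]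
    [MeasurableSpace β] [BorelSpace β] {f : α → β} (hf : Continuous f)
    (hns : ¬ CountablyInjOn f univ) : ∃ D : Set α, D.Nonempty ∧ Splits f D := by
  classical
  have hfm : Measurable f := hf.measurable
  let b := TopologicalSpace.countableBasis α
  have hbc : Countable b := (TopologicalSpace.countable_countableBasis α).to_subtype
  have hbo : ∀ U : b, IsOpen U.1 := fun U => TopologicalSpace.isOpen_of_mem_countableBasis U.2
  have hB := TopologicalSpace.isBasis_countableBasis α
  -- Countably many configuration types: a finite tuple of basic open sets with one marked index.
  let T := Σ k : ℕ, (Fin k → b) × Fin k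
  let proj : T → Set α → Set α := fun t C =>
    (fun g : Fin t.1 → α => g t.2.2) '' {g | Realizes f Cᶜ (fun j => (t.2.1 j).1) g}
  have hmono : ∀ t C C', C ⊆ C' → proj t C' ⊆ proj t C := by
    rintro t C C' h _ ⟨g, hg, rfl⟩
    exact ⟨g, hg.mono (compl_subset_compl.2 h) fun _ => Subset.rfl, rfl⟩
  -- `P t` says that a small set can be removed so that `f` becomes injective on the possible
  -- positions of the marked point. `E` below collects one such set for each `t`.
  let P : T → Prop := fun t =>
    ∃ C, MeasurableSet C ∧ CountablyInjOn f C ∧ InjOn f (proj t C)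
  let C : T → Set α := fun t => if h : P t then h.choose else ∅
  have hCm : ∀ t, MeasurableSet (C t) := by
    intro t
    by_cases h : P t
    · simpa [C, h] using h.choose_spec.1
    · simp [C, h]
  have hCs : ∀ t, CountablyInjOn f (C t) := by
    intro t
    by_cases h : P t
    · simpa [C, h] using h.choose_spec.2.1
    · simpa [C, h] using CountablyInjOn.of_injOn MeasurableSet.empty (injOn_empty f)
  have hCi : ∀ t, P t → InjOn f (proj t (C t)) := by
    intro t h
    simpa [C, h] using h.choose_spec.2.2
  let E := ⋃ t, C t
  have hEm : MeasurableSet E := MeasurableSet.iUnion hCm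
  have hEi : ∀ t, P t → InjOn f (proj t E) := fun t h =>
    (hCi t h).mono (hmono _ _ _ (subset_iUnion C t))
  have hproj : ∀ t, AnalyticSet (proj t E) := by
    intro t
    refine MeasurableSet.analyticSet_image ?_ (measurable_pi_apply _)
    have : {g : Fin t.1 → α | Realizes f Eᶜ (fun j => (t.2.1 j).1) g} =
        (⋂ j, (fun g => g j) ⁻¹' ((t.2.1 j).1 ∩ Eᶜ)) ∩
          ⋂ j, ⋂ j', {g | f (g j) = f (g j')} := by
      ext g
      simp [Realizes]
    rw [this]
    refine (MeasurableSet.iInter fun j => measurable_pi_apply j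
      ((hbo _).measurableSet.inter hEm.compl)).inter ?_
    exact MeasurableSet.iInter fun j => MeasurableSet.iInter fun j' =>
      measurableSet_eq_fun (hfm.comp (measurable_pi_apply j)) (hfm.comp (measurable_pi_apply j'))
  have hull : ∀ t : {t // P t}, ∃ B, MeasurableSet B ∧ proj t.1 E ⊆ B ∧ InjOn f B := fun t =>
    exists_measurableSet_superset_injOn hf hfm (hproj t.1) (hEi t.1 t.2)
  choose K hK1 hK2 hK3 using hull
  -- Removing the hulls `K t` as well kills the marked points for every `t` with `P t`, so the types
  -- still realized outside `C'` all fail `P`.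
  let C' := E ∪ ⋃ t, K t
  have hC's : CountablyInjOn f C' := by
    have : C' = ⋃ s : Bool, cond s E (⋃ t, K t) := union_eq_iUnion
    rw [this]
    refine CountablyInjOn.iUnion fun s => ?_
    cases s
    · exact CountablyInjOn.iUnion fun t => CountablyInjOn.of_injOn (hK1 t) (hK3 t)
    · exact CountablyInjOn.iUnion hCs
  have hC'm : MeasurableSet C' := hEm.union (MeasurableSet.iUnion hK1)
  refine ⟨C'ᶜ, ?_, ?_⟩
  · rw [nonempty_iff_ne_empty]
    intro h
    rw [compl_empty_iff] at h
    exact hns (h ▸ hC's)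
  · rintro k U hU ⟨g, hg⟩ i
    have hV : ∀ j, ∃ V : b, g j ∈ V.1 ∧ V.1 ⊆ U j := by
      intro j
      obtain ⟨V, hV, h1, h2⟩ := hB.exists_subset_of_mem_open (hg.1 j).1 (hU j)
      exact ⟨⟨V, hV⟩, h1, h2⟩
    choose V hgV hVU using hV
    let t : T := ⟨k, V, i⟩
    have hgr : Realizes f C'ᶜ (fun j => (V j).1) g := ⟨fun j => ⟨hgV j, (hg.1 j).2⟩, hg.2⟩
    have hnP : ¬ P t := by
      intro hP
      have h1 : g i ∈ proj t E :=
        ⟨g, hgr.mono (compl_subset_compl.2 subset_union_left) fun _ => Subset.rfl, rfl⟩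
      exact (hg.1 i).2 (Or.inr (mem_iUnion.2 ⟨⟨t, hP⟩, hK2 ⟨t, hP⟩ h1⟩))
    -- `C'` is itself small; as `P t` fails, it cannot make the marked projection injective, and
    -- this failure is the required splitting.
    have hni : ¬ InjOn f (proj t C') := fun h => hnP ⟨C', hC'm, hC's, h⟩
    simp only [InjOn] at hni
    push Not at hni
    obtain ⟨_, ⟨p, hp, rfl⟩, _, ⟨q, hq, rfl⟩, hpq, hne⟩ := hni
    exact ⟨p, q, hp.mono Subset.rfl hVU, hq.mono Subset.rfl hVU, hne, hpq⟩

lemma Splits.fintype [TopologicalSpace α] {f : α → β} {D : Set α} (h : Splits f D)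
    {ι : Type*} [Finite ι] (U : ι → Set α) (hU : ∀ j, IsOpen (U j)) (hg : ∃ g, Realizes f D U g)
    (i : ι) : ∃ p q, Realizes f D U p ∧ Realizes f D U q ∧ p i ≠ q i ∧ f (p i) = f (q i) := by
  obtain ⟨k, ⟨e⟩⟩ := Finite.exists_equiv_fin ι
  obtain ⟨g, hg⟩ := hg
  obtain ⟨p, q, hp, hq, h1, h2⟩ := h k (U ∘ e.symm) (fun j => hU _)
    ⟨g ∘ e.symm, fun j => hg.1 _, fun j j' => hg.2 _ _⟩ (e i)
  refine ⟨p ∘ e, q ∘ e, ⟨fun j => ?_, fun j j' => hp.2 _ _⟩,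
    ⟨fun j => ?_, fun j j' => hq.2 _ _⟩, h1, h2⟩
  · simpa using hp.1 (e j)
  · simpa using hq.1 (e j)

/-- In a splitting set all of finitely many points can be split simultaneously. -/
lemma Splits.split_all [TopologicalSpace α] [T2Space α] {f : α → β} {D : Set α} (h : Splits f D)
    {ι : Type*} [Finite ι] (U : ι → Set α) (hU : ∀ j, IsOpen (U j))
    (hg : ∃ g, Realizes f D U g) :
    ∃ p : ι ⊕ ι → α, Realizes f D (Sum.elim U U) p ∧ ∀ i, p (Sum.inl i) ≠ p (Sum.inr i) := by
  classical
  have := Fintype.ofFinite ι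
  suffices H : ∀ T : Finset ι, ∃ p : ι ⊕ ι → α, Realizes f D (Sum.elim U U) p ∧
      ∀ i ∈ T, p (Sum.inl i) ≠ p (Sum.inr i) by
    obtain ⟨p, hp, h1⟩ := H Finset.univ
    exact ⟨p, hp, fun i => h1 i (Finset.mem_univ i)⟩
  intro T
  induction T using Finset.induction_on with
  | empty =>
    obtain ⟨g, hg⟩ := hg
    refine ⟨Sum.elim g g, ⟨?_, ?_⟩, by simp⟩
    · rintro (j | j) <;> exact hg.1 j
    · rintro (j | j) (j' | j') <;> exact hg.2 j j'
  | insert i T hi ih =>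
    obtain ⟨p, hp, hpT⟩ := ih
    have hsep : ∀ j : T, ∃ V W, IsOpen V ∧ IsOpen W ∧ p (Sum.inl j.1) ∈ V ∧
        p (Sum.inr j.1) ∈ W ∧ Disjoint V W := fun j => t2_separation (hpT j.1 j.2)
    choose V W hV hW hpV hpW hVW using hsep
    let V' : ι → Set α := fun j => if hj : j ∈ T then V ⟨j, hj⟩ else univ
    let W' : ι → Set α := fun j => if hj : j ∈ T then W ⟨j, hj⟩ else univ
    have hV' : ∀ j, IsOpen (V' j) := by
      intro j
      by_cases hj : j ∈ T
      · simpa [V', hj] using hV _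
      · simp [V', hj]
    have hW' : ∀ j, IsOpen (W' j) := by
      intro j
      by_cases hj : j ∈ T
      · simpa [W', hj] using hW _
      · simp [W', hj]
    have hpV' : ∀ j, p (Sum.inl j) ∈ V' j := by
      intro j
      by_cases hj : j ∈ T
      · simpa [V', hj] using hpV ⟨j, hj⟩
      · simp [V', hj]
    have hpW' : ∀ j, p (Sum.inr j) ∈ W' j := by
      intro j
      by_cases hj : j ∈ T
      · simpa [W', hj] using hpW ⟨j, hj⟩
      · simp [W', hj]
    have hVW' : ∀ j ∈ T, Disjoint (V' j) (W' j) := by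
      intro j hj
      simpa [V', W', hj] using hVW ⟨j, hj⟩
    -- The splitting property is applied to the doubled family, shrunk by separating neighborhoods
    -- so that the pairs already split remain split.
    obtain ⟨a, c, ha, hc, hac, hfac⟩ := h.fintype
      (Sum.elim (fun j => U j ∩ V' j) (fun j => U j ∩ W' j))
      (by rintro (j | j)
          · exact (hU j).inter (hV' j)
          · exact (hU j).inter (hW' j))
      ⟨p, by rintro (j | j)
             · exact ⟨⟨(hp.1 (Sum.inl j)).1, hpV' j⟩, (hp.1 (Sum.inl j)).2⟩
             · exact ⟨⟨(hp.1 (Sum.inr j)).1, hpW' j⟩, (hp.1 (Sum.inr j)).2⟩, hp.2⟩ (Sum.inl i)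
    -- Only the second copy of `i` is replaced. By `hfac` the new point lies in the same fiber as
    -- all the points of `a`.
    refine ⟨Function.update a (Sum.inr i) (c (Sum.inl i)), ⟨?_, ?_⟩, ?_⟩
    · intro j
      by_cases hj : j = Sum.inr i
      · subst hj
        simpa using ⟨(hc.1 (Sum.inl i)).1.1, (hc.1 (Sum.inl i)).2⟩
      · rw [Function.update_of_ne hj]
        have := ha.1 j
        rcases j with j | j
        · exact ⟨this.1.1, this.2⟩
        · exact ⟨this.1.1, this.2⟩
    · have key : ∀ j, f (Function.update a (Sum.inr i) (c (Sum.inl i)) j) = f (a (Sum.inl i)) := by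
        intro j
        by_cases hj : j = Sum.inr i
        · subst hj
          simpa using hfac.symm
        · rw [Function.update_of_ne hj]
          exact ha.2 _ _
      intro j j'
      rw [key, key]
    · intro j hj
      by_cases hji : j = i
      · subst hji
        simpa using hac
      · rw [Function.update_of_ne (by simp), Function.update_of_ne (by simpa using hji)]
        have hjT : j ∈ T := (Finset.mem_insert.1 hj).resolve_left hji
        intro heq
        refine Set.disjoint_left.1 (hVW' j hjT) (ha.1 (Sum.inl j)).1.2 ?_
        rw [heq]
        exact (ha.1 (Sum.inr j)).1.2

/-- One step in the construction of a Cantor scheme from a splitting set. -/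
lemma Splits.exists_step [MetricSpace α] {f : α → β} {D : Set α} (h : Splits f D)
    {n : ℕ} (U : List.Vector Bool n → Set α) (hU : ∀ j, IsOpen (U j))
    (hg : ∃ g, Realizes f D U g) :
    ∃ V : List.Vector Bool (n + 1) → Set α, (∀ j, IsOpen (V j)) ∧ (∃ g, Realizes f D V g) ∧
      (∀ j, closure (V j) ⊆ U j.tail) ∧
      (∀ j, Metric.ediam (V j) ≤ ENNReal.ofReal (2 * (1 / (n + 1)))) ∧
      ∀ j : List.Vector Bool n, Disjoint (V (true ::ᵥ j)) (V (false ::ᵥ j)) := by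
  classical
  obtain ⟨p, hp, hne⟩ := h.split_all U hU hg
  let g : List.Vector Bool (n + 1) → α := fun v =>
    if v.head then p (Sum.inl v.tail) else p (Sum.inr v.tail)
  have hgU : ∀ v, g v ∈ U v.tail := by
    intro v
    simp only [g]
    split_ifs
    · exact (hp.1 (Sum.inl v.tail)).1
    · exact (hp.1 (Sum.inr v.tail)).1
  have hgD : ∀ v, g v ∈ D := by
    intro v
    simp only [g]
    split_ifs
    · exact (hp.1 (Sum.inl v.tail)).2
    · exact (hp.1 (Sum.inr v.tail)).2
  have hgf : ∀ v v', f (g v) = f (g v') := by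
    intro v v'
    simp only [g]
    split_ifs <;> exact hp.2 _ _
  have hε : ∀ v, ∃ ε > 0, Metric.ball (g v) ε ⊆ U v.tail := fun v =>
    Metric.isOpen_iff.1 (hU _) _ (hgU v)
  choose ε hε0 hεU using hε
  have hδ : ∀ j : List.Vector Bool n, 0 < dist (g (true ::ᵥ j)) (g (false ::ᵥ j)) := by
    intro j
    rw [dist_pos]
    simpa [g] using hne j
  -- The three bounds serve, in order, the closure inclusion in the parent set, the diameter
  -- estimate and the disjointness of siblings.
  let r : List.Vector Bool (n + 1) → ℝ := fun v =>
    min (min (ε v / 2) (1 / (n + 1))) (dist (g (true ::ᵥ v.tail)) (g (false ::ᵥ v.tail)) / 2)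
  have hr : ∀ v, 0 < r v := fun v =>
    lt_min (lt_min (half_pos (hε0 v)) (by positivity)) (half_pos (hδ _))
  refine ⟨fun v => Metric.ball (g v) (r v), fun v => Metric.isOpen_ball,
    ⟨g, fun v => ⟨Metric.mem_ball_self (hr v), hgD v⟩, hgf⟩, ?_, ?_, ?_⟩
  · intro v
    refine Metric.closure_ball_subset_closedBall.trans (Subset.trans ?_ (hεU v))
    refine Metric.closedBall_subset_ball ?_
    have : r v ≤ ε v / 2 := (min_le_left _ _).trans (min_le_left _ _)
    linarith [hε0 v]
  · intro v
    refine Metric.ediam_le fun x hx y hy => ?_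
    rw [edist_dist]
    refine ENNReal.ofReal_le_ofReal ?_
    have h1 : r v ≤ 1 / (n + 1) := (min_le_left _ _).trans (min_le_right _ _)
    have h2 := dist_triangle_right x y (g v)
    rw [Metric.mem_ball] at hx hy
    linarith
  · intro j
    refine Metric.ball_disjoint_ball ?_
    have h1 : r (true ::ᵥ j) ≤ _ := min_le_right _ _
    have h2 : r (false ::ᵥ j) ≤ _ := min_le_right _ _
    simp only [List.Vector.tail_cons] at h1 h2
    linarith

/-- A nonempty splitting set gives rise to an uncountable fiber. -/
lemma Splits.exists_uncountable_fiber [TopologicalSpace α] [PolishSpace α] [TopologicalSpace β]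
    [T2Space β] {f : α → β} (hf : Continuous f) {D : Set α} (h : Splits f D)
    (hD : D.Nonempty) : ∃ y, ¬ (f ⁻¹' {y}).Countable := by
  classical
  let := TopologicalSpace.upgradeIsCompletelyMetrizable α
  let St : ℕ → Type _ := fun n =>
    {U : List.Vector Bool n → Set α // (∀ j, IsOpen (U j)) ∧ ∃ g, Realizes f D U g}
  have hstep : ∀ n (s : St n), ∃ t : St (n + 1), (∀ j, closure (t.1 j) ⊆ s.1 j.tail) ∧
      (∀ j, Metric.ediam (t.1 j) ≤ ENNReal.ofReal (2 * (1 / (n + 1)))) ∧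
      ∀ j : List.Vector Bool n, Disjoint (t.1 (true ::ᵥ j)) (t.1 (false ::ᵥ j)) := by
    intro n s
    obtain ⟨V, h1, h2, h3⟩ := h.exists_step s.1 s.2.1 s.2.2
    exact ⟨⟨V, h1, h2⟩, h3⟩
  choose step hs1 hs2 hs3 using hstep
  obtain ⟨d, hd⟩ := hD
  let st : ∀ n, St n := fun n => Nat.rec (motive := St)
    ⟨fun _ => univ, fun _ => isOpen_univ, fun _ => d, fun _ => ⟨mem_univ _, hd⟩, fun _ _ => rfl⟩
    step n
  have hst : ∀ n, st (n + 1) = step n (st n) := fun _ => rfl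
  -- The newest bit is at the head of the list, matching `PiNat.res`.
  let A : List Bool → Set α := fun l => (st l.length).1 ⟨l, rfl⟩
  have hAcons : ∀ (l : List Bool) (b : Bool),
      A (b :: l) = (step l.length (st l.length)).1 (b ::ᵥ ⟨l, rfl⟩) := fun _ _ => rfl
  have hanti : CantorScheme.ClosureAntitone A := by
    intro l b
    rw [hAcons]
    exact hs1 _ _ _
  have hdisj : CantorScheme.Disjoint A := by
    intro l a b hab
    have := hs3 _ (st l.length) ⟨l, rfl⟩
    change Disjoint (A (a :: l)) (A (b :: l))
    rw [hAcons, hAcons]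
    cases a <;> cases b
    · exact absurd rfl hab
    · exact this.symm
    · exact this
    · exact absurd rfl hab
  have hlim : Tendsto (fun n : ℕ => ENNReal.ofReal (2 * (1 / ((n : ℝ) + 1)))) atTop (𝓝 0) := by
    have := (tendsto_one_div_add_atTop_nhds_zero_nat (𝕜 := ℝ)).const_mul 2
    rw [mul_zero] at this
    simpa using ENNReal.tendsto_ofReal this
  have hdiam : CantorScheme.VanishingDiam A := by
    intro x
    rw [← tendsto_add_atTop_iff_nat 1]
    refine tendsto_of_tendsto_of_tendsto_of_le_of_le tendsto_const_nhds hlim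
      (fun _ => zero_le) fun n => ?_
    have := hs2 _ (st (PiNat.res x n).length) (x n ::ᵥ ⟨PiNat.res x n, rfl⟩)
    rw [← hAcons] at this
    simpa using this
  choose g hg using fun n => (st n).2.2
  have hgA : ∀ (x : ℕ → Bool) n, g n ⟨PiNat.res x n, PiNat.res_length x n⟩ ∈ A (PiNat.res x n) := by
    have : ∀ n (l : List Bool) (hl : l.length = n), g n ⟨l, hl⟩ ∈ A l := by
      rintro n l rfl
      exact ((hg l.length).1 ⟨l, rfl⟩).1
    exact fun x n => this n _ _
  have hne : ∀ l, (A l).Nonempty := fun l => ⟨_, ((hg l.length).1 ⟨l, rfl⟩).1⟩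
  have hdom := hanti.map_of_vanishingDiam hdiam hne
  let F : (ℕ → Bool) → α := fun x => (CantorScheme.inducedMap A).2 ⟨x, hdom ▸ mem_univ x⟩
  have hFinj : Function.Injective F := by
    intro x y hxy
    exact congrArg Subtype.val (hdisj.map_injective hxy)
  have hFlim : ∀ x, Tendsto (fun n => g n ⟨PiNat.res x n, PiNat.res_length x n⟩) atTop
      (𝓝 (F x)) := by
    intro x
    rw [Metric.tendsto_atTop]
    intro δ hδ
    obtain ⟨N, hN⟩ := hdiam.dist_lt δ hδ x
    refine ⟨N, fun n hn => hN _ ?_ _ (CantorScheme.map_mem _ N)⟩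
    have hmono : Antitone fun n => A (PiNat.res x n) :=
      antitone_nat_of_succ_le fun n => hanti.antitone _ _
    exact hmono hn (hgA x n)
  -- All points of the `n`-th realization share one fiber, and those along the branch of `x`
  -- converge to `F x`; continuity of `f` passes this to the limits.
  have hconst : ∀ x y, f (F x) = f (F y) := by
    intro x y
    refine tendsto_nhds_unique ((hf.tendsto _).comp (hFlim x)) ?_
    refine ((hf.tendsto _).comp (hFlim y)).congr fun n => ?_
    exact (hg n).2 _ _
  refine ⟨f (F fun _ => true), fun hc => ?_⟩
  have hsub : range F ⊆ f ⁻¹' {f (F fun _ => true)} := by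
    rintro _ ⟨x, rfl⟩
    exact hconst _ _
  have hcr : (F '' univ).Countable := by
    rw [image_univ]
    exact hc.mono hsub
  have := countable_of_injective_of_countable_image hFinj.injOn hcr
  rw [countable_univ_iff] at this
  obtain ⟨e, he⟩ := exists_surjective_nat (ℕ → Bool)
  obtain ⟨n, hn⟩ := he fun n => !(e n n)
  simpa using congrFun hn n

/-- The **Lusin–Novikov theorem**: a countable-to-one Borel map between standard Borel spaces is
injective on each member of some countable Borel cover. -/
theorem exists_iUnion_injOn [MeasurableSpace α] [StandardBorelSpace α] [MeasurableSpace β]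
    [StandardBorelSpace β] {f : α → β} (hf : Measurable f)
    (hc : ∀ y, (f ⁻¹' {y}).Countable) :
    ∃ B : ℕ → Set α, (∀ n, MeasurableSet (B n)) ∧ (∀ n, InjOn f (B n)) ∧ ⋃ n, B n = univ := by
  let tα := upgradeStandardBorel α
  let := upgradeStandardBorel β
  -- A finer Polish topology makes `f` continuous without changing the Borel sets.
  obtain ⟨τ', hle, hfc, hτ'⟩ := hf.exists_continuous
  have hbor : @BorelSpace α τ' _ :=
    ⟨(@BorelSpace.measurable_eq α tα.toTopologicalSpace _ _).trans
      (borel_eq_borel_of_le hτ' tα.toPolishSpace hle).symm⟩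
  by_contra hcon
  have hns : ¬ CountablyInjOn f univ := by
    rintro ⟨B, h1, h2, h3⟩
    exact hcon ⟨B, h1, h2, univ_subset_iff.1 h3⟩
  obtain ⟨D, hD, hs⟩ := @exists_nonempty_splits α β τ' hτ' _ hbor _ _ _ _ _ f hfc hns
  obtain ⟨y, hy⟩ := @Splits.exists_uncountable_fiber α β τ' hτ' _ _ f hfc D hs hD
  exact hy (hc y)

end LusinNovikov

/-! ### Borel sections and bundles of product spaces -/

section Bundle

variable {X : Type u} [Groupoid.{v} X]

lemma arrowOf_injective {x : X} : Function.Injective (arrowOf : Quiver.Costar x → _) := by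
  rintro ⟨a, f⟩ ⟨b, g⟩ h
  simp only [arrowOf, Quiver.Total.mk.injEq, true_and] at h
  obtain ⟨rfl, h⟩ := h
  rw [eq_of_heq h]

lemma exists_arrowOf_eq (g : Quiver.Total X) : ∃ w : Quiver.Costar g.right, arrowOf w = g :=
  ⟨⟨g.left, g.hom⟩, rfl⟩

variable [MeasurableSpace X] [MeasurableSpace (Quiver.Total X)]

/-- Countably many Borel sections of the range map exhaust a discrete Borel groupoid. -/
lemma IsDiscreteBorel.exists_sections (hX : IsDiscreteBorel X) :
    ∃ ρ : ℕ → ∀ x : X, Quiver.Costar x, (∀ n, Measurable fun x => arrowOf (ρ n x)) ∧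
      ∀ x (w : Quiver.Costar x), ∃ n, ρ n x = w := by
  classical
  have := hX.standardBorel_units
  have := hX.standardBorel_arrows
  obtain ⟨B, hBm, hBi, hB⟩ := exists_iUnion_injOn hX.measurable_range hX.countable_range
  -- The unique arrow of `B n` with range `x`, or the unit at `x` where `B n` has none.
  let ρ : ℕ → ∀ x : X, Quiver.Costar x := fun n x =>
    if h : ∃ w : Quiver.Costar x, arrowOf w ∈ B n then h.choose else ⟨x, 𝟙 x⟩
  have hρ : ∀ n x (w : Quiver.Costar x), arrowOf w ∈ B n → ρ n x = w := by
    intro n x w hw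
    have h : ∃ w : Quiver.Costar x, arrowOf w ∈ B n := ⟨w, hw⟩
    have h' : ρ n x = h.choose := dif_pos h
    rw [h']
    exact arrowOf_injective (hBi n h.choose_spec hw rfl)
  refine ⟨ρ, fun n A hA => ?_, fun x w => ?_⟩
  · have himg : ∀ D : Set (Quiver.Total X), MeasurableSet D →
        MeasurableSet ((fun g : Quiver.Total X => g.right) '' (B n ∩ D)) := fun D hD =>
      ((hBm n).inter hD).image_of_measurable_injOn hX.measurable_range
        ((hBi n).mono inter_subset_left)
    have : (fun x => arrowOf (ρ n x)) ⁻¹' A =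
        ((fun g : Quiver.Total X => g.right) '' (B n ∩ A)) ∪
        (((fun g : Quiver.Total X => g.right) '' (B n ∩ univ))ᶜ ∩
          (fun x : X => (⟨x, x, 𝟙 x⟩ : Quiver.Total X)) ⁻¹' A) := by
      ext x
      by_cases h : ∃ w : Quiver.Costar x, arrowOf w ∈ B n
      · obtain ⟨w, hw⟩ := h
        have h1 : x ∈ (fun g : Quiver.Total X => g.right) '' (B n ∩ univ) :=
          ⟨arrowOf w, ⟨hw, mem_univ _⟩, rfl⟩
        simp only [mem_preimage, hρ n x w hw, mem_union, mem_inter_iff, mem_compl_iff, h1,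
          not_true_eq_false, false_and, or_false]
        constructor
        · exact fun h => ⟨arrowOf w, ⟨hw, h⟩, rfl⟩
        · rintro ⟨g, ⟨hg, hgA⟩, hgx⟩
          have : g = arrowOf w := hBi n hg hw hgx
          rwa [← this]
      · have h' : ρ n x = ⟨x, 𝟙 x⟩ := dif_neg h
        have h1 : ∀ D, x ∉ (fun g : Quiver.Total X => g.right) '' (B n ∩ D) := by
          rintro D ⟨g, ⟨hg, -⟩, rfl⟩
          obtain ⟨w, hw⟩ := exists_arrowOf_eq g
          exact h ⟨w, by rw [hw]; exact hg⟩
        simp only [mem_preimage, h', mem_union, h1, false_or, mem_inter_iff, mem_compl_iff,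
          not_false_eq_true, true_and]
        rfl
    rw [this]
    exact (himg A hA).union ((himg univ MeasurableSet.univ).compl.inter (hX.measurable_id hA))
  · obtain ⟨n, hn⟩ := mem_iUnion.1 (hB ▸ mem_univ (arrowOf w))
    exact ⟨n, hρ n x w hn⟩

/-- There is a Borel function on the arrows that enumerates each fiber of the range map. -/
lemma IsDiscreteBorel.exists_enumeration (hX : IsDiscreteBorel X) :
    ∃ e : Quiver.Total X → ℕ, Measurable e ∧
      ∀ x, Function.Injective fun w : Quiver.Costar x => e (arrowOf w) := by
  classical
  have := hX.standardBorel_units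
  have := hX.standardBorel_arrows
  obtain ⟨B, hBm, hBi, hB⟩ := exists_iUnion_injOn hX.measurable_range hX.countable_range
  have hex : ∀ g : Quiver.Total X, ∃ n, g ∈ B n := fun g => mem_iUnion.1 (hB ▸ mem_univ g)
  refine ⟨fun g => Nat.find (hex g), measurable_find hex hBm, fun x w w' hww => ?_⟩
  have h1 := Nat.find_spec (hex (arrowOf w))
  have h2 := Nat.find_spec (hex (arrowOf w'))
  simp only at hww
  rw [← hww] at h2
  exact arrowOf_injective (hBi _ h1 h2 rfl)

lemma IsDiscreteBorel.countable_costar (hX : IsDiscreteBorel X) (x : X) :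
    Countable (Quiver.Costar x) := by
  have := (hX.countable_range x).to_subtype
  exact Function.Injective.countable (β := {g : Quiver.Total X | g.right = x})
    (f := fun w => ⟨arrowOf w, rfl⟩) fun w w' h => arrowOf_injective (congrArg Subtype.val h)

variable {Y : Type u'} [MeasurableSpace Y]

lemma measurable_tensorPower_base : Measurable (TensorPower.base : TensorPower X Y → X) :=
  measurable_iff_comap_le.2 le_sup_left

lemma measurable_tensorPower_val {σ : ∀ x : X, Quiver.Costar x}
    (hσ : Measurable fun x => arrowOf (σ x)) :
    Measurable fun y : TensorPower X Y => y.val (σ y.base) :=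
  measurable_iff_comap_le.2 (le_sup_of_le_right (le_iSup₂_of_le σ hσ le_rfl))

lemma measurable_to_tensorPower {α : Type*} [MeasurableSpace α] {f : α → TensorPower X Y}
    (hb : Measurable fun a => (f a).base)
    (hv : ∀ σ : ∀ x : X, Quiver.Costar x, (Measurable fun x => arrowOf (σ x)) →
      Measurable fun a => (f a).val (σ (f a).base)) : Measurable f := by
  rw [measurable_iff_comap_le]
  refine MeasurableSpace.comap_le_iff_le_map.2 (sup_le ?_ (iSup₂_le fun σ hσ => ?_))
  · rintro _ ⟨A, hA, rfl⟩
    exact hb hA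
  · rintro _ ⟨A, hA, rfl⟩
    exact hv σ hσ hA

lemma measurable_tensorPower_mk (x : X) :
    Measurable (TensorPower.mk x : (Quiver.Costar x → Y) → TensorPower X Y) :=
  measurable_to_tensorPower measurable_const fun σ _ => measurable_pi_apply (σ x)

/-- Evaluation of a measurable family of points of `Y^{⊗𝒢}` at a measurable family of arrows. -/
lemma IsDiscreteBorel.measurable_val (hX : IsDiscreteBorel X) {α : Type*} [MeasurableSpace α]
    {f : α → TensorPower X Y} (hf : Measurable f) {k : ∀ a, Quiver.Costar (f a).base}
    (hk : Measurable fun a => arrowOf (k a)) : Measurable fun a => (f a).val (k a) := by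
  have := hX.standardBorel_arrows
  obtain ⟨ρ, hρm, hρ⟩ := hX.exists_sections
  intro A hA
  -- `k a` need not depend on the base point alone, so it is compared with each of the exhausting
  -- sections.
  have : (fun a => (f a).val (k a)) ⁻¹' A = ⋃ n,
      {a | arrowOf (k a) = arrowOf (ρ n (f a).base)} ∩
        (fun a => (f a).val (ρ n (f a).base)) ⁻¹' A := by
    ext a
    simp only [mem_preimage, mem_iUnion, mem_inter_iff, mem_ofPred_eq]
    constructor
    · intro h
      obtain ⟨n, hn⟩ := hρ _ (k a)
      exact ⟨n, by rw [hn], by rwa [hn]⟩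
    · rintro ⟨n, hn, h⟩
      rwa [arrowOf_injective hn]
  rw [this]
  exact MeasurableSet.iUnion fun n =>
    (measurableSet_eq_fun hk ((hρm n).comp (measurable_tensorPower_base.comp hf))).inter
      ((measurable_tensorPower_val (hρm n)).comp hf hA)

/-- The fibers of a measurable fiber-preserving map are measurable. -/
lemma IsDiscreteBorel.measurable_of_totalMap (hX : IsDiscreteBorel X) {Z : Type u''}
    [MeasurableSpace Z] {φ : ∀ x : X, (Quiver.Costar x → Y) → (Quiver.Costar x → Z)}
    (hφ : Measurable (totalMap φ)) (x : X) : Measurable (φ x) := by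
  refine measurable_pi_iff.2 fun w => ?_
  exact hX.measurable_val (f := fun b => totalMap φ ⟨x, b⟩) (k := fun _ => w)
    (hφ.comp (measurable_tensorPower_mk x)) (measurable_const (a := arrowOf w))

/-- Restricting the coordinates of an infinite power along an injection. -/
lemma infinitePi_map_comp_injective {ι κ : Type*} (ν : Measure Y) [IsProbabilityMeasure ν]
    {e : κ → ι} (he : Function.Injective e) :
    (Measure.infinitePi fun _ : ι => ν).map (fun (z : ι → Y) k => z (e k)) =
      Measure.infinitePi fun _ : κ => ν := by
  classical
  refine Measure.eq_infinitePi _ fun s t ht => ?_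
  rw [Measure.map_apply (by fun_prop) (.pi s.countable_toSet fun i _ => ht i)]
  have : (fun (z : ι → Y) k => z (e k)) ⁻¹' (Set.pi (s : Set κ) t) =
      Set.pi (s.map ⟨e, he⟩ : Finset ι) (Function.extend e t fun _ => univ) := by
    ext z
    simp [Set.mem_pi, he.extend_apply]
  rw [this, Measure.infinitePi_pi, Finset.prod_map]
  · simp [he.extend_apply]
  · intro i hi
    obtain ⟨k, -, rfl⟩ := Finset.mem_map.1 hi
    simpa [he.extend_apply] using ht k

instance fiberMeasure.isProbabilityMeasure (ν : Measure Y) [IsProbabilityMeasure ν] (x : X) :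
    IsProbabilityMeasure (fiberMeasure ν x) := by
  unfold fiberMeasure
  infer_instance

/-- The product measures on the fibers form a measurable family. -/
lemma IsDiscreteBorel.measurable_fiberMeasure (hX : IsDiscreteBorel X) (ν : Measure Y)
    [IsProbabilityMeasure ν] :
    Measurable fun x : X => (fiberMeasure ν x).map (TensorPower.mk x) := by
  obtain ⟨e, hem, he⟩ := hX.exists_enumeration
  -- The index sets x𝒢 vary with `x`, but `e` embeds them all in ℕ, so every fiber measure is an
  -- image of one fixed measure on `ℕ → Y`.
  let Φ : X × (ℕ → Y) → TensorPower X Y := fun p => ⟨p.1, fun w => p.2 (e (arrowOf w))⟩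
  have hΦ : Measurable Φ := by
    refine measurable_to_tensorPower measurable_fst fun σ hσ => ?_
    have h1 : Measurable fun p : (ℕ → Y) × ℕ => p.1 p.2 :=
      measurable_from_prod_countable_left fun n => measurable_pi_apply n
    exact h1.comp (measurable_snd.prodMk ((hem.comp hσ).comp measurable_fst))
  have key : (fun x : X => (fiberMeasure ν x).map (TensorPower.mk x)) = fun x =>
      ((Measure.infinitePi fun _ : ℕ => ν).map (Prod.mk x)).map Φ := by
    ext1 x
    rw [fiberMeasure, ← infinitePi_map_comp_injective ν (he x),
      Measure.map_map (measurable_tensorPower_mk x) (by fun_prop),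
      Measure.map_map hΦ (by fun_prop)]
    rfl
  rw [key]
  exact (Measure.measurable_map Φ hΦ).comp Measurable.map_prodMk_left

/-- A property holding almost everywhere on `Y^{⊗𝒢}` holds almost everywhere on almost every
fiber. -/
lemma IsDiscreteBorel.ae_ae_of_ae_tensorMeasure (hX : IsDiscreteBorel X) {μ : Measure X}
    {ν : Measure Y} [IsProbabilityMeasure ν] {P : TensorPower X Y → Prop}
    (h : ∀ᵐ y ∂tensorMeasure μ ν, P y) :
    ∀ᵐ x ∂μ, ∀ᵐ b ∂fiberMeasure ν x, P ⟨x, b⟩ := by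
  have := Measure.ae_ae_of_ae_bind (hX.measurable_fiberMeasure ν).aemeasurable h
  filter_upwards [this] with x hx
  exact ae_of_ae_map (measurable_tensorPower_mk x).aemeasurable hx

/-- Converse of the previous lemma. The exceptional set is measurable, so its `bind` measure is
bounded by the integral of its fiber measures. -/
lemma ae_tensorMeasure_of_ae_ae {μ : Measure X} {ν : Measure Y} {P : TensorPower X Y → Prop}
    (hP : MeasurableSet {y | P y}) (h : ∀ᵐ x ∂μ, ∀ᵐ b ∂fiberMeasure ν x, P ⟨x, b⟩) :
    ∀ᵐ y ∂tensorMeasure μ ν, P y := by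
  rw [ae_iff]
  refine le_antisymm ((Measure.bind_apply_le _ hP.compl).trans ?_) (zero_le)
  rw [nonpos_iff_eq_zero]
  refine lintegral_eq_zero_of_ae_eq_zero ?_
  filter_upwards [h] with x hx
  rw [Measure.map_apply (measurable_tensorPower_mk x) hP.compl]
  exact hx

/-- The coincidence set of two measurable maps into a bundle of product spaces. -/
lemma IsDiscreteBorel.measurableSet_eq_tensorPower (hX : IsDiscreteBorel X)
    [StandardBorelSpace Y] {φ ψ : ∀ x : X, (Quiver.Costar x → Y) → (Quiver.Costar x → Y)}
    (hφ : Measurable (totalMap φ)) (hψ : Measurable (totalMap ψ)) :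
    MeasurableSet {y : TensorPower X Y | totalMap φ y = totalMap ψ y} := by
  obtain ⟨ρ, hρm, hρ⟩ := hX.exists_sections
  have : {y : TensorPower X Y | totalMap φ y = totalMap ψ y} =
      ⋂ n, {y | (totalMap φ y).val (ρ n y.base) = (totalMap ψ y).val (ρ n y.base)} := by
    ext y
    simp only [totalMap, mem_ofPred_eq, TensorPower.mk.injEq, heq_eq_eq, true_and, mem_iInter]
    refine ⟨fun h n => by rw [h], fun h => funext fun w => ?_⟩
    obtain ⟨n, rfl⟩ := hρ _ w
    exact h n
  rw [this]
  exact MeasurableSet.iInter fun n => measurableSet_eq_fun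
    ((measurable_tensorPower_val (hρm n)).comp hφ) ((measurable_tensorPower_val (hρm n)).comp hψ)

/-- In a discrete p.m.p. groupoid a property of almost every unit holds, for almost every `x`, at
the sources of all arrows with range `x`. -/
lemma IsDiscretePMP.ae_forall_costar {μ : Measure X} (hX : IsDiscretePMP μ) {P : X → Prop}
    (hP : ∀ᵐ x ∂μ, P x) : ∀ᵐ x ∂μ, ∀ w : Quiver.Costar x, P w.1 := by
  have := hX.standardBorel_units
  have := hX.standardBorel_arrows
  obtain ⟨B, hBm, hBi, hB⟩ :=
    exists_iUnion_injOn hX.measurable_range hX.countable_range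
  obtain ⟨N, hPN, hNm, hN⟩ := exists_measurable_superset_of_null (ae_iff.1 hP)
  let A : Set (Quiver.Total X) := (fun g => g.left) ⁻¹' N
  have hA : MeasurableSet A := hX.measurable_source hNm
  have h0 : ∫⁻ x, Measure.count (A ∩ {g | g.right = x}) ∂μ = 0 := by
    rw [hX.lintegral_count_eq A hA]
    refine lintegral_eq_zero_of_ae_eq_zero ?_
    have : ∀ᵐ x ∂μ, x ∉ N := by
      rw [ae_iff]
      simpa using hN
    filter_upwards [this] with x hx
    have : A ∩ {g | g.left = x} = ∅ := by
      ext g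
      simp only [A, mem_inter_iff, mem_preimage, mem_ofPred_eq, mem_empty_iff_false, iff_false]
      rintro ⟨h1, rfl⟩
      exact hx h1
    simp [this]
  have himg : ∀ n, MeasurableSet ((fun g : Quiver.Total X => g.right) '' (B n ∩ A)) := fun n =>
    ((hBm n).inter hA).image_of_measurable_injOn hX.measurable_range
      ((hBi n).mono inter_subset_left)
  have hR : MeasurableSet (⋃ n, (fun g : Quiver.Total X => g.right) '' (B n ∩ A)) :=
    MeasurableSet.iUnion himg
  rw [← image_iUnion, ← iUnion_inter, hB, univ_inter] at hR
  -- The indicator of the set of ranges of `A` is at most the number of arrows of `A` with the given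
  -- range, whose integral vanishes by `h0`.
  have hR0 : μ ((fun g : Quiver.Total X => g.right) '' A) = 0 := by
    rw [← nonpos_iff_eq_zero, ← h0, ← lintegral_indicator_one hR]
    refine lintegral_mono fun x => ?_
    by_cases hx : x ∈ (fun g : Quiver.Total X => g.right) '' A
    · rw [indicator_of_mem hx]
      obtain ⟨g, hg, rfl⟩ := hx
      calc (1 : ℝ≥0∞) = Measure.count {g} := (Measure.count_singleton g).symm
        _ ≤ Measure.count (A ∩ {g' | g'.right = g.right}) :=
          measure_mono (singleton_subset_iff.2 ⟨hg, rfl⟩)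
    · rw [indicator_of_notMem hx]
      exact zero_le
  rw [ae_iff]
  refine measure_mono_null ?_ hR0
  intro x hx
  simp only [mem_ofPred_eq, not_forall] at hx
  obtain ⟨w, hw⟩ := hx
  exact ⟨arrowOf w, hPN hw, rfl⟩

/-- Measurability of the composition of two measurable families of arrows. -/
lemma IsDiscreteBorel.measurable_arrow_comp (hX : IsDiscreteBorel X) {α : Type*}
    [MeasurableSpace α] {x y z : α → X} {f : ∀ a, x a ⟶ y a} {g : ∀ a, y a ⟶ z a}
    (hf : Measurable fun a => (⟨x a, y a, f a⟩ : Quiver.Total X))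
    (hg : Measurable fun a => (⟨y a, z a, g a⟩ : Quiver.Total X)) :
    Measurable fun a => (⟨x a, z a, f a ≫ g a⟩ : Quiver.Total X) :=
  hX.measurable_comp.comp (g := fun p : Composable X => (⟨p.x, p.z, p.fst ≫ p.snd⟩ : Quiver.Total X))
    (f := fun a => (⟨x a, y a, z a, f a, g a⟩ : Composable X)) (by
      rw [measurable_comap_iff]
      exact hf.prodMk hg)

lemma IsDiscreteBorel.measurable_arrow_inv (hX : IsDiscreteBorel X) {α : Type*}
    [MeasurableSpace α] {x y : α → X} {f : ∀ a, x a ⟶ y a}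
    (hf : Measurable fun a => (⟨x a, y a, f a⟩ : Quiver.Total X)) :
    Measurable fun a => (⟨y a, x a, inv (f a)⟩ : Quiver.Total X) :=
  hX.measurable_inv.comp hf

end Bundle

/-! ### Wide Borel subgroupoids -/

lemma standardBorelSpace_of_measurableEquiv {α β : Type*} [MeasurableSpace α] [MeasurableSpace β]
    [StandardBorelSpace β] (e : α ≃ᵐ β) : StandardBorelSpace α := by
  let := upgradeStandardBorel β
  refine ⟨TopologicalSpace.induced e inferInstance, @BorelSpace.mk _ (_) _ ?_,
    e.toEquiv.polishSpace_induced⟩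
  rw [borel_comap, ← BorelSpace.measurable_eq (α := β)]
  exact e.measurableEmbedding.comap_eq.symm

section Wide

variable {X : Type u} [Groupoid.{v} X] {H : Subgroupoid X}

/-- A unit of the ambient groupoid, seen as a unit of a wide subgroupoid. -/
abbrev wideUnit (hH : H.IsWide) (a : X) : H.objs := ⟨a, 𝟙 a, hH.id_mem a⟩

lemma inclArrow_injective : Function.Injective (inclArrow H) := by
  rintro ⟨⟨a, ha⟩, ⟨b, hb⟩, f⟩ ⟨⟨a', ha'⟩, ⟨b', hb'⟩, f'⟩ h
  simp only [inclArrow, Quiver.Total.mk.injEq] at h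
  obtain ⟨rfl, rfl, h⟩ := h
  congr 1
  exact Subtype.ext (eq_of_heq h)

lemma mem_range_inclArrow {g : Quiver.Total X} :
    g ∈ range (inclArrow H) ↔ g.hom ∈ H.arrows g.left g.right := by
  constructor
  · rintro ⟨h, rfl⟩
    exact h.hom.2
  · intro h
    exact ⟨⟨⟨g.left, H.mem_objs_of_src h⟩, ⟨g.right, H.mem_objs_of_tgt h⟩, ⟨g.hom, h⟩⟩, rfl⟩

lemma inv_mem_arrows {a b : X} {f : a ⟶ b} (hf : f ∈ H.arrows a b) : inv f ∈ H.arrows b a := by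
  rw [← Groupoid.inv_eq_inv]
  exact H.inv hf

lemma coe_inv_objs {a b : H.objs} (k : a ⟶ b) : (inv k).1 = inv k.1 := by
  rw [← Groupoid.inv_eq_inv, ← Groupoid.inv_eq_inv]
  rfl

lemma ae_wideUnit_of_ae_comap [MeasurableSpace X] (hH : H.IsWide) {μ : Measure X} {P : H.objs → Prop}
    (h : ∀ᵐ x ∂μ.comap Subtype.val, P x) : ∀ᵐ x ∂μ, P (wideUnit hH x) := by
  have hobj : MeasurableSet H.objs := by
    rw [(H.isWide_iff_objs_eq_univ).1 hH]
    exact MeasurableSet.univ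
  rw [ae_iff, (MeasurableEmbedding.subtype_coe hobj).comap_apply] at h
  refine measure_mono_null ?_ h
  intro x hx
  exact ⟨wideUnit hH x, hx, rfl⟩

variable [MeasurableSpace (Quiver.Total X)]

lemma measurableEmbedding_inclArrow (hHm : MeasurableSet (range (inclArrow H))) :
    MeasurableEmbedding (inclArrow H) where
  injective := inclArrow_injective
  measurable := comap_measurable _
  measurableSet_image' := by
    rintro _ ⟨t, ht, rfl⟩
    rw [image_preimage_eq_inter_range]
    exact ht.inter hHm

variable [MeasurableSpace X]

/-- A wide Borel subgroupoid of a discrete Borel groupoid is a discrete Borel groupoid. -/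
lemma IsDiscreteBorel.subgroupoid (hX : IsDiscreteBorel X) (hH : H.IsWide)
    (hHm : MeasurableSet (range (inclArrow H))) : IsDiscreteBorel H.objs := by
  have := hX.standardBorel_units
  have := hX.standardBorel_arrows
  have hobj : MeasurableSet H.objs := by
    rw [(H.isWide_iff_objs_eq_univ).1 hH]
    exact MeasurableSet.univ
  have hincl := measurableEmbedding_inclArrow hHm
  refine ⟨hobj.standardBorel, ?_, ?_, ?_, fun x => ?_, fun x => ?_, ?_, ?_, ?_⟩
  · have := hHm.standardBorel
    exact standardBorelSpace_of_measurableEquiv hincl.equivRange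
  · exact (hX.measurable_source.comp hincl.measurable).subtype_mk
  · exact (hX.measurable_range.comp hincl.measurable).subtype_mk
  · refine (((hX.countable_source x.1).preimage inclArrow_injective)).mono ?_
    rintro h rfl
    rfl
  · refine (((hX.countable_range x.1).preimage inclArrow_injective)).mono ?_
    rintro h rfl
    rfl
  · rw [measurable_comap_iff]
    exact hX.measurable_id.comp measurable_subtype_coe
  · rw [measurable_comap_iff]
    convert hX.measurable_inv.comp hincl.measurable using 1
    ext1 h
    simp only [Function.comp_apply, inclArrow, coe_inv_objs]
  · rw [measurable_comap_iff]
    refine hX.measurable_arrow_comp (f := fun p : Composable H.objs => p.fst.1)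
      (g := fun p : Composable H.objs => p.snd.1) ?_ ?_
    · exact hincl.measurable.comp (measurable_fst.comp (comap_measurable Composable.toPair))
    · exact hincl.measurable.comp (measurable_snd.comp (comap_measurable Composable.toPair))

end Wide

/-! ### Decomposition into left cosets -/

section Coset

variable {X : Type u} [Groupoid.{v} X] {H : Subgroupoid X} (hH : H.IsWide)

/-- The parametrization `h ↦ σh` of the left coset `σH`. -/
def cosetMap {x : X} (σ : Quiver.Costar x) (h : Quiver.Costar (wideUnit hH σ.1)) :
    Quiver.Costar x :=
  ⟨h.1.1, h.2.1 ≫ σ.2⟩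

lemma cosetMap_injective {x : X} (σ : Quiver.Costar x) :
    Function.Injective (cosetMap hH σ) := by
  rintro ⟨⟨a, ha⟩, f⟩ ⟨⟨b, hb⟩, g⟩ h
  simp only [cosetMap, Sigma.mk.injEq] at h
  obtain ⟨rfl, h⟩ := h
  have h' := (cancel_mono σ.2).1 (eq_of_heq h)
  congr 1
  exact Subtype.ext h'

variable {S : Set (Quiver.Total X)} (hS : IsLeftCosetReps H S)

/-- The representative of the left coset of `w`. -/
def cosetRep {x : X} (w : Quiver.Costar x) : Quiver.Costar x := (hS x w).choose

lemma cosetRep_mem {x : X} (w : Quiver.Costar x) : cosetRep hS w ∈ fiberSet S x :=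
  (hS x w).choose_spec.1.1

lemma cosetRep_mem_leftCoset {x : X} (w : Quiver.Costar x) : cosetRep hS w ∈ leftCoset H w :=
  (hS x w).choose_spec.1.2

lemma eq_cosetRep {x : X} {w σ : Quiver.Costar x} (h1 : σ ∈ fiberSet S x)
    (h2 : σ ∈ leftCoset H w) : σ = cosetRep hS w :=
  (hS x w).choose_spec.2 σ ⟨h1, h2⟩

/-- In the form σ⁻¹w ∈ ℋ, coset membership is a Borel condition, and σ⁻¹w is the coordinate of `w`
in σℋ. -/
lemma mem_leftCoset_iff {x : X} {w σ : Quiver.Costar x} :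
    σ ∈ leftCoset H w ↔ w.2 ≫ inv σ.2 ∈ H.arrows w.1 σ.1 := by
  constructor
  · rintro ⟨h, hh, he⟩
    rw [he]
    simpa using inv_mem_arrows hh
  · intro h
    exact ⟨inv (w.2 ≫ inv σ.2), inv_mem_arrows h, by simp⟩

/-- The element `h` of `H` such that `w = σh`, where `σ` represents the left coset of `w`. -/
def cosetCoord {x : X} (w : Quiver.Costar x) : Quiver.Costar (wideUnit hH (cosetRep hS w).1) :=
  ⟨wideUnit hH w.1, w.2 ≫ inv (cosetRep hS w).2,
    mem_leftCoset_iff.1 (cosetRep_mem_leftCoset hS w)⟩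

lemma cosetMap_cosetCoord {x : X} (w : Quiver.Costar x) :
    cosetMap hH (cosetRep hS w) (cosetCoord hH hS w) = w := by
  simp [cosetMap, cosetCoord, wideUnit]

lemma cosetRep_cosetMap {x : X} {σ : Quiver.Costar x} (hσ : σ ∈ fiberSet S x)
    (h : Quiver.Costar (wideUnit hH σ.1)) : cosetRep hS (cosetMap hH σ h) = σ := by
  refine (eq_cosetRep hS hσ (mem_leftCoset_iff.2 ?_)).symm
  simp only [cosetMap, Category.assoc, IsIso.hom_inv_id, Category.comp_id]
  exact h.2.2

/-- The decomposition of `x𝒢` into left cosets. -/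
def cosetEquiv (x : X) :
    Quiver.Costar x ≃ Σ σ : fiberSet S x, Quiver.Costar (wideUnit hH σ.1.1) where
  toFun w := ⟨⟨cosetRep hS w, cosetRep_mem hS w⟩, cosetCoord hH hS w⟩
  invFun p := cosetMap hH p.1.1 p.2
  left_inv w := cosetMap_cosetCoord hH hS w
  right_inv := by
    rintro ⟨⟨σ, hσ⟩, h⟩
    -- The types depend on the representative, so `w` is kept as a variable to allow substituting
    -- `cosetRep hS w` for `σ`.
    have key : ∀ w, w = cosetMap hH σ h →
        (⟨⟨cosetRep hS w, cosetRep_mem hS w⟩, cosetCoord hH hS w⟩ :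
          Σ σ : fiberSet S x, Quiver.Costar (wideUnit hH σ.1.1)) = ⟨⟨σ, hσ⟩, h⟩ := by
      intro w hw
      have h1 : cosetRep hS w = σ := by rw [hw, cosetRep_cosetMap hH hS hσ]
      subst h1
      refine Sigma.ext rfl (heq_of_eq (cosetMap_injective hH _ ?_))
      rw [cosetMap_cosetCoord, ← hw]
    exact key _ rfl

/-! ### Maps acting separately on each left coset. -/

variable {Y : Type u'} {Z : Type u''}

/-- The map `Y^{⊗𝒢} → Z^{⊗𝒢}` that acts on each left coset like a given map
`Y^{⊗H} → Z^{⊗H}`. -/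
def cosetwise (φ : ∀ x : H.objs, (Quiver.Costar x → Y) → (Quiver.Costar x → Z)) (x : X)
    (b : Quiver.Costar x → Y) : Quiver.Costar x → Z := fun w =>
  φ (wideUnit hH (cosetRep hS w).1) (fun h => b (cosetMap hH (cosetRep hS w) h))
    (cosetCoord hH hS w)

lemma cosetwise_cosetMap (φ : ∀ x : H.objs, (Quiver.Costar x → Y) → (Quiver.Costar x → Z))
    {x : X} (b : Quiver.Costar x → Y) {σ : Quiver.Costar x} (hσ : σ ∈ fiberSet S x)
    (h : Quiver.Costar (wideUnit hH σ.1)) :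
    cosetwise hH hS φ x b (cosetMap hH σ h) =
      φ (wideUnit hH σ.1) (fun h => b (cosetMap hH σ h)) h := by
  obtain ⟨w, hw⟩ : ∃ w, w = cosetMap hH σ h := ⟨_, rfl⟩
  have h1 : cosetRep hS w = σ := by rw [hw, cosetRep_cosetMap hH hS hσ]
  rw [← hw]
  subst h1
  have h2 : cosetCoord hH hS w = h :=
    cosetMap_injective hH _ (by rw [cosetMap_cosetCoord, ← hw])
  rw [← h2]
  rfl

/-! ### Cosetwise maps and product measures. -/

section Measure

variable [MeasurableSpace Y] [MeasurableSpace Z]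

lemma fiberMeasure_map_cosetMap (ν : Measure Y) [IsProbabilityMeasure ν] {x : X}
    (σ : Quiver.Costar x) :
    (fiberMeasure ν x).map (fun b h => b (cosetMap hH σ h)) = fiberMeasure ν (wideUnit hH σ.1) :=
  infinitePi_map_comp_injective ν (cosetMap_injective hH σ)

/-- Restriction to one coset is measure preserving, so null sets for ℋ pull back to null sets for 𝒢.
-/
lemma ae_fiberMeasure_cosetMap {ν : Measure Y} [IsProbabilityMeasure ν] {x : X}
    (σ : Quiver.Costar x) {P : (Quiver.Costar (wideUnit hH σ.1) → Y) → Prop}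
    (h : ∀ᵐ b ∂fiberMeasure ν (wideUnit hH σ.1), P b) :
    ∀ᵐ b ∂fiberMeasure ν x, P fun h => b (cosetMap hH σ h) := by
  rw [← fiberMeasure_map_cosetMap hH ν σ] at h
  exact ae_of_ae_map (measurable_pi_lambda _ fun h => measurable_pi_apply _).aemeasurable h

/-- The product measure over `x𝒢` is the product of the product measures over the left cosets. -/
lemma infinitePi_map_cosetEquiv (ν : Measure Y) [IsProbabilityMeasure ν] (x : X) :
    (Measure.infinitePi fun σ : fiberSet S x => fiberMeasure ν (wideUnit hH σ.1.1)).map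
      (fun f w => f (cosetEquiv hH hS x w).1 (cosetEquiv hH hS x w).2) = fiberMeasure ν x := by
  have h1 := Measure.infinitePi_map_piCurry_symm
    (fun (σ : fiberSet S x) (_ : Quiver.Costar (wideUnit hH σ.1.1)) => ν)
  rw [fiberMeasure, ← infinitePi_map_comp_injective ν (cosetEquiv hH hS x).injective, ← h1,
    Measure.map_map (by fun_prop) (by fun_prop)]
  rfl

/-- In coset coordinates `cosetwise` is a product of maps, and a product of measure preserving maps
preserves the product measure. -/
lemma fiberMeasure_map_cosetwise {ν : Measure Y} [IsProbabilityMeasure ν] {η : Measure Z}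
    [IsProbabilityMeasure η]
    {φ : ∀ x : H.objs, (Quiver.Costar x → Y) → (Quiver.Costar x → Z)}
    (hφ : ∀ x, Measurable (φ x)) {x : X}
    (h : ∀ σ : Quiver.Costar x, (fiberMeasure ν (wideUnit hH σ.1)).map (φ (wideUnit hH σ.1)) =
      fiberMeasure η (wideUnit hH σ.1)) :
    (fiberMeasure ν x).map (cosetwise hH hS φ x) = fiberMeasure η x := by
  have hm : Measurable (cosetwise hH hS φ x) := by
    refine measurable_pi_iff.2 fun w => ?_
    exact (measurable_pi_apply _).comp ((hφ _).comp (by fun_prop))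
  rw [← infinitePi_map_cosetEquiv hH hS ν x, ← infinitePi_map_cosetEquiv hH hS η x,
    Measure.map_map hm (by fun_prop)]
  simp_rw [← h]
  rw [← Measure.infinitePi_map_pi _ (fun σ => hφ _), Measure.map_map (by fun_prop)]
  · congr 1
    ext f w
    obtain ⟨p, rfl⟩ := (cosetEquiv hH hS x).symm.surjective w
    have : (cosetEquiv hH hS x).symm p = cosetMap hH p.1.1 p.2 := rfl
    have hf : (fun l => f (cosetEquiv hH hS x (cosetMap hH p.1.1 l)).1
        (cosetEquiv hH hS x (cosetMap hH p.1.1 l)).2) = f p.1 :=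
      funext fun l => congrArg
        (fun r : Σ σ : fiberSet S x, Quiver.Costar (wideUnit hH σ.1.1) => f r.1 r.2)
        ((cosetEquiv hH hS x).apply_symm_apply ⟨p.1, l⟩)
    simp only [Function.comp_apply]
    rw [Equiv.apply_symm_apply, this, cosetwise_cosetMap hH hS φ _ p.1.2, hf]
  · exact measurable_pi_iff.2 fun σ => (hφ _).comp (measurable_pi_apply σ)

/-! ### Measurability and almost everywhere invertibility of cosetwise maps. -/

variable [MeasurableSpace X] [MeasurableSpace (Quiver.Total X)]

/-- Uniqueness makes the chosen representative definable: it is the value `ρ n x` lying in `S` and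
in the coset, a Borel condition for each `n`. -/
lemma measurable_arrowOf_cosetRep (hX : IsDiscreteBorel X)
    (hHm : MeasurableSet (range (inclArrow H))) (hSm : MeasurableSet S)
    {σ : ∀ x : X, Quiver.Costar x} (hσ : Measurable fun x => arrowOf (σ x)) :
    Measurable fun x => arrowOf (cosetRep hS (σ x)) := by
  obtain ⟨ρ, hρm, hρ⟩ := hX.exists_sections
  intro A hA
  have : (fun x => arrowOf (cosetRep hS (σ x))) ⁻¹' A = ⋃ n,
      (fun x => arrowOf (ρ n x)) ⁻¹' (S ∩ A) ∩
        (fun x => (⟨(σ x).1, (ρ n x).1, (σ x).2 ≫ inv (ρ n x).2⟩ : Quiver.Total X)) ⁻¹'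
          (range (inclArrow H)) := by
    ext x
    simp only [mem_preimage, mem_iUnion, mem_inter_iff, mem_range_inclArrow,
      ← mem_leftCoset_iff]
    constructor
    · intro h
      obtain ⟨n, hn⟩ := hρ x (cosetRep hS (σ x))
      refine ⟨n, ?_⟩
      rw [hn]
      exact ⟨⟨cosetRep_mem hS _, h⟩, cosetRep_mem_leftCoset hS _⟩
    · rintro ⟨n, ⟨h1, h2⟩, h3⟩
      rwa [← eq_cosetRep hS h1 h3]
  rw [this]
  refine MeasurableSet.iUnion fun n => (hρm n (hSm.inter hA)).inter ?_
  exact hX.measurable_arrow_comp hσ (hX.measurable_arrow_inv (hρm n)) hHm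

lemma measurable_totalMap_cosetwise (hX : IsDiscreteBorel X)
    (hHm : MeasurableSet (range (inclArrow H))) (hSm : MeasurableSet S)
    {φ : ∀ x : H.objs, (Quiver.Costar x → Y) → (Quiver.Costar x → Z)}
    (hφ : Measurable (totalMap φ)) : Measurable (totalMap (cosetwise hH hS φ)) := by
  refine measurable_to_tensorPower measurable_tensorPower_base fun σ hσ => ?_
  have hτ := measurable_arrowOf_cosetRep hS hX hHm hSm hσ
  have hu : Measurable fun x => wideUnit hH (cosetRep hS (σ x)).1 :=
    (hX.measurable_source.comp hτ).subtype_mk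
  -- Restriction of `y` to the coset of `σ y.base`; the required coordinate is that of `totalMap φ
  -- (T y)` at a measurably varying arrow of ℋ.
  let T : TensorPower X Y → TensorPower H.objs Y := fun y =>
    ⟨wideUnit hH (cosetRep hS (σ y.base)).1,
      fun h => y.val (cosetMap hH (cosetRep hS (σ y.base)) h)⟩
  have hT : Measurable T := by
    refine measurable_to_tensorPower (hu.comp measurable_tensorPower_base) fun ρ hρ => ?_
    refine measurable_tensorPower_val
      (σ := fun x => cosetMap hH (cosetRep hS (σ x)) (ρ (wideUnit hH (cosetRep hS (σ x)).1))) ?_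
    exact hX.measurable_arrow_comp ((comap_measurable (inclArrow H)).comp (hρ.comp hu)) hτ
  refine (hX.subgroupoid hH hHm).measurable_val (f := fun y => totalMap φ (T y))
    (k := fun y => cosetCoord hH hS (σ y.base)) (hφ.comp hT) ?_
  rw [measurable_comap_iff]
  have hc : Measurable fun x => (⟨(σ x).1, (cosetRep hS (σ x)).1,
      (σ x).2 ≫ inv (cosetRep hS (σ x)).2⟩ : Quiver.Total X) :=
    hX.measurable_arrow_comp hσ (hX.measurable_arrow_inv hτ)
  exact hc.comp measurable_tensorPower_base

/-- The composite acts cosetwise as ψ ∘ φ. For almost every `x` this is almost surely the identity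
on each of the countably many cosets. -/
lemma ae_cosetwise_leftInverse {μ : Measure X} (hX : IsDiscretePMP μ)
    (hHm : MeasurableSet (range (inclArrow H))) (hSm : MeasurableSet S)
    [StandardBorelSpace Y] {ν : Measure Y} [IsProbabilityMeasure ν]
    {φ : ∀ x : H.objs, (Quiver.Costar x → Y) → (Quiver.Costar x → Z)}
    {ψ : ∀ x : H.objs, (Quiver.Costar x → Z) → (Quiver.Costar x → Y)}
    (hφ : Measurable (totalMap φ)) (hψ : Measurable (totalMap ψ))
    (h : ∀ᵐ y ∂tensorMeasure (μ.comap Subtype.val) ν, totalMap ψ (totalMap φ y) = y) :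
    ∀ᵐ y ∂tensorMeasure μ ν,
      totalMap (cosetwise hH hS ψ) (totalMap (cosetwise hH hS φ) y) = y := by
  refine ae_tensorMeasure_of_ae_ae ?_ ?_
  · exact hX.measurableSet_eq_tensorPower
      (φ := fun x b => cosetwise hH hS ψ x (cosetwise hH hS φ x b)) (ψ := fun _ b => b)
      ((measurable_totalMap_cosetwise hH hS hX.toIsDiscreteBorel hHm hSm hψ).comp
        (measurable_totalMap_cosetwise hH hS hX.toIsDiscreteBorel hHm hSm hφ)) measurable_id
  have h1 := (hX.toIsDiscreteBorel.subgroupoid hH hHm).ae_ae_of_ae_tensorMeasure h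
  filter_upwards [hX.ae_forall_costar (ae_wideUnit_of_ae_comap hH h1)] with x hx
  have := hX.countable_costar x
  have h2 : ∀ᵐ b ∂fiberMeasure ν x, ∀ σ : Quiver.Costar x,
      totalMap ψ (totalMap φ ⟨wideUnit hH σ.1, fun h => b (cosetMap hH σ h)⟩) =
        ⟨wideUnit hH σ.1, fun h => b (cosetMap hH σ h)⟩ :=
    ae_all_iff.2 fun σ => ae_fiberMeasure_cosetMap hH σ (hx σ)
  filter_upwards [h2] with b hb
  simp only [totalMap, TensorPower.mk.injEq, heq_eq_eq, true_and] at hb ⊢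
  ext w
  have h3 : (fun h => cosetwise hH hS φ x b (cosetMap hH (cosetRep hS w) h)) =
      φ _ (fun h => b (cosetMap hH (cosetRep hS w) h)) :=
    funext fun h => cosetwise_cosetMap hH hS φ b (cosetRep_mem hS w) h
  rw [cosetwise, h3, hb]
  exact congrArg b (cosetMap_cosetCoord hH hS w)

end Measure

end Coset

/-! ### Cofinite equivariance -/

section Cofinite

/-- Thinness makes an arrow a unit exactly when its endpoints coincide, so finiteness can be counted
on points instead of arrows. -/
lemma nonempty_directSumHom_iff {I : Type*} {Y : Type*} [Groupoid Y] [Quiver.IsThin Y]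
    {a b : I → Y} :
    Nonempty (DirectSumHom a b) ↔ (∀ i, Nonempty (a i ⟶ b i)) ∧ {i | a i ≠ b i}.Finite := by
  constructor
  · rintro ⟨t⟩
    refine ⟨fun i => ⟨t.coord i⟩, t.finite.subset fun i hi => ?_⟩
    rintro ⟨h, -⟩
    exact hi h
  · rintro ⟨h1, h2⟩
    refine ⟨⟨fun i => (h1 i).some, h2.subset fun i hi h => hi ⟨h, Subsingleton.elim _ _⟩⟩⟩

variable {X : Type u} [Groupoid.{v} X] {H : Subgroupoid X} (hH : H.IsWide)
  {S : Set (Quiver.Total X)} (hS : IsLeftCosetReps H S)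

lemma leftTranslate_injective {a b : X} (g : a ⟶ b) : Function.Injective (leftTranslate g) := by
  rintro ⟨c, f⟩ ⟨c', f'⟩ h
  simp only [leftTranslate, Sigma.mk.injEq] at h
  obtain ⟨rfl, h⟩ := h
  rw [(cancel_mono g).1 (eq_of_heq h)]

lemma shift_inv_apply {Y : Type*} {a b : X} (g : a ⟶ b) (k : Quiver.Costar b → Y)
    (w : Quiver.Costar a) : shift (inv g) k w = k (leftTranslate g w) := by
  simp [shift]

lemma shift_leftTranslate {Y : Type*} {a b : X} (g : a ⟶ b) (k : Quiver.Costar a → Y)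
    (w : Quiver.Costar a) : shift g k (leftTranslate g w) = k w := by
  simp [shift, leftTranslate]

/-- If left translation by `g` moves only finitely many coset representatives, then maps acting
cosetwise inherit cofinite equivariance. -/
lemma isCofinitelyEquivariant_cosetwise [MeasurableSpace X] [MeasurableSpace (Quiver.Total X)]
    (hX : IsDiscreteBorel X)
    (hSfin : ∀ ⦃a b : X⦄ (g : a ⟶ b),
      (symmDiff (leftTranslate g '' fiberSet S a) (fiberSet S b)).Finite)
    {Y : Type u'} [Groupoid.{v'} Y] [Quiver.IsThin Y] {Z : Type u''} [Groupoid.{v''} Z]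
    [Quiver.IsThin Z] [MeasurableSpace Y] {ν : Measure Y} [IsProbabilityMeasure ν]
    {φ : ∀ x : H.objs, (Quiver.Costar x → Y) → (Quiver.Costar x → Z)}
    (hφ : IsCofinitelyEquivariant ν φ) :
    IsCofinitelyEquivariant ν (cosetwise hH hS φ) := by
  intro p q g
  have := hX.countable_costar p
  let τ : Quiver.Costar p → Quiver.Costar q := fun σ => cosetRep hS (leftTranslate g σ)
  -- The element of ℋ with gσ = τk: translation by `g` from σℋ to τℋ is translation by `k` in coset
  -- coordinates.
  let k : ∀ σ : Quiver.Costar p, wideUnit hH σ.1 ⟶ wideUnit hH (τ σ).1 := fun σ =>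
    ⟨(leftTranslate g σ).2 ≫ inv (τ σ).2,
      mem_leftCoset_iff.1 (cosetRep_mem_leftCoset hS (leftTranslate g σ))⟩
  have hk : ∀ σ h, leftTranslate g (cosetMap hH σ h) =
      cosetMap hH (τ σ) (leftTranslate (k σ) h) := by
    intro σ h
    simp [leftTranslate, cosetMap, k]
  have hae : ∀ᵐ a ∂fiberMeasure ν p, ∀ σ : Quiver.Costar p,
      ∀ (b : Quiver.Costar (wideUnit hH σ.1) → Y)
        (_ : DirectSumHom (fun h => a (cosetMap hH σ h)) b),
        Nonempty (DirectSumHom (φ (wideUnit hH σ.1) fun h => a (cosetMap hH σ h))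
          (shift (inv (k σ)) (φ (wideUnit hH (τ σ).1) (shift (k σ) b)))) :=
    ae_all_iff.2 fun σ => ae_fiberMeasure_cosetMap hH σ (hφ (k σ))
  filter_upwards [hae] with a ha b t
  obtain ⟨ht1, ht2⟩ := nonempty_directSumHom_iff.1 ⟨t⟩
  set F : Quiver.Costar p → Z :=
    shift (inv g) (cosetwise hH hS φ q (shift g b)) with hF
  have hFσ : ∀ σ h, F (cosetMap hH σ h) = shift (inv (k σ))
      (φ (wideUnit hH (τ σ).1) (shift (k σ) fun h => b (cosetMap hH σ h))) h := by
    intro σ h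
    rw [hF, shift_inv_apply, hk, cosetwise_cosetMap hH hS φ _ (cosetRep_mem hS _),
      shift_inv_apply]
    congr 2
    ext l
    obtain ⟨l, rfl⟩ : ∃ l', leftTranslate (k σ) l' = l :=
      ⟨leftTranslate (inv (k σ)) l, by simp [leftTranslate]⟩
    rw [shift_leftTranslate, ← hk, shift_leftTranslate]
  -- When gσ is again a representative, `g` merely relabels the coset, and equivariance is exact
  -- there.
  have hFS : ∀ σ, leftTranslate g σ ∈ fiberSet S q → ∀ h, F (cosetMap hH σ h) =
      φ (wideUnit hH σ.1) (fun h => b (cosetMap hH σ h)) h := by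
    intro σ hσ h
    have h1 : ∀ h, leftTranslate g (cosetMap hH σ h) = cosetMap hH (leftTranslate g σ) h :=
      fun h => Sigma.ext rfl (heq_of_eq (Category.assoc _ _ _))
    have h2 : (fun l => shift g b (cosetMap hH (leftTranslate g σ) l)) =
        fun l => b (cosetMap hH σ l) :=
      funext fun l => (congrArg (shift g b) (h1 l)).symm.trans (shift_leftTranslate g b _)
    rw [hF, shift_inv_apply]
    exact (congrArg (cosetwise hH hS φ q (shift g b)) (h1 h)).trans
      ((cosetwise_cosetMap hH hS φ _ hσ h).trans (congrFun (congrArg (φ (wideUnit hH σ.1)) h2) h))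
  have hrestr : ∀ σ, Nonempty (DirectSumHom (φ (wideUnit hH σ.1) fun h => a (cosetMap hH σ h))
      (fun h => F (cosetMap hH σ h))) := by
    intro σ
    simp_rw [hFσ]
    refine ha σ _ (Nonempty.some (nonempty_directSumHom_iff.2 ⟨fun h => ht1 _, ?_⟩))
    exact ht2.preimage (cosetMap_injective hH σ).injOn
  simp_rw [nonempty_directSumHom_iff] at hrestr
  refine nonempty_directSumHom_iff.2 ⟨fun w => ?_, ?_⟩
  · obtain ⟨σ, h, hσ, rfl⟩ : ∃ σ h, σ ∈ fiberSet S p ∧ cosetMap hH σ h = w :=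
      ⟨_, _, cosetRep_mem hS w, cosetMap_cosetCoord hH hS w⟩
    rw [cosetwise_cosetMap hH hS φ _ hσ]
    exact (hrestr σ).1 h
  -- The possibly bad cosets: `g` moves the representative out of Σ, or `a` and `b` differ somewhere
  -- on the coset. Each contributes finitely many errors by `hrestr`, and all others contribute none
  -- by `hFS`.
  · let T : Set (Quiver.Costar p) :=
      leftTranslate g ⁻¹' (symmDiff (leftTranslate g '' fiberSet S p) (fiberSet S q)) ∪
        cosetRep hS '' {w | a w ≠ b w}
    have hT : T.Finite :=
      ((hSfin g).preimage (leftTranslate_injective g).injOn).union (ht2.image _)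
    refine (hT.biUnion fun σ _ => (hrestr σ).2.image (cosetMap hH σ)).subset fun w hw => ?_
    obtain ⟨σ, h, hσ, rfl⟩ : ∃ σ h, σ ∈ fiberSet S p ∧ cosetMap hH σ h = w :=
      ⟨_, _, cosetRep_mem hS w, cosetMap_cosetCoord hH hS w⟩
    simp only [mem_ofPred_eq, cosetwise_cosetMap hH hS φ _ hσ] at hw
    refine mem_biUnion (x := σ) ?_ ⟨h, hw, rfl⟩
    by_contra hσT
    simp only [T, mem_union, not_or] at hσT
    have h1 : leftTranslate g σ ∈ fiberSet S q := by
      by_contra h1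
      exact hσT.1 (Or.inl ⟨⟨σ, hσ, rfl⟩, h1⟩)
    have h2 : ∀ l, a (cosetMap hH σ l) = b (cosetMap hH σ l) := by
      intro l
      by_contra h2
      exact hσT.2 ⟨_, h2, cosetRep_cosetMap hH hS hσ l⟩
    apply hw
    rw [hFS σ h1]
    simp_rw [h2]

end Cofinite

end PMPGroupoid

end

/-! ### The main theorem. -/

open PMPGroupoid in
theorem mainTheorem7
    {X : Type u} [Groupoid.{v} X] [MeasurableSpace X] [MeasurableSpace (Quiver.Total X)]
    (μ : Measure X) (hX : PMPGroupoid.IsDiscretePMP μ)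
    (H : Subgroupoid X) (hH : H.IsWide)
    (hHmeas : MeasurableSet (range (PMPGroupoid.inclArrow H)))
    (S : Set (Quiver.Total X)) (hSmeas : MeasurableSet S)
    (hS : PMPGroupoid.IsLeftCosetReps H S)
    (hSfin : ∀ ⦃a b : X⦄ (g : a ⟶ b),
      (symmDiff (PMPGroupoid.leftTranslate g '' PMPGroupoid.fiberSet S a)
        (PMPGroupoid.fiberSet S b)).Finite)
    {B : Type u'} [Groupoid.{v'} B] [MeasurableSpace B] [MeasurableSpace (Quiver.Total B)]
    [Quiver.IsThin B] (ν : Measure B) (hB : PMPGroupoid.IsDiscretePMP ν)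
    {C : Type u''} [Groupoid.{v''} C] [MeasurableSpace C] [MeasurableSpace (Quiver.Total C)]
    [Quiver.IsThin C] (η : Measure C) (hC : PMPGroupoid.IsDiscretePMP η)
    (h : ∃ φH : ∀ x : H.objs, (Quiver.Costar x → B) → (Quiver.Costar x → C),
      PMPGroupoid.IsBiCofiniteIso (μ.comap Subtype.val) ν η φH) :
    ∃ φ : ∀ x : X, (Quiver.Costar x → B) → (Quiver.Costar x → C),
      PMPGroupoid.IsBiCofiniteIso μ ν η φ := by
  obtain ⟨φ, ⟨hφm, -, hφmap⟩, hφc, ψ, ⟨hψm, hψφ, hφψ⟩, hψc⟩ := h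
  have := hB.isProbabilityMeasure
  have := hC.isProbabilityMeasure
  have := hB.standardBorel_units
  have := hC.standardBorel_units
  have hG := hX.toIsDiscreteBorel
  have hleft := ae_cosetwise_leftInverse hH hS hX hHmeas hSmeas hφm hψm hψφ
  have hright := ae_cosetwise_leftInverse hH hS hX hHmeas hSmeas hψm hφm hφψ
  refine ⟨cosetwise hH hS φ, ⟨measurable_totalMap_cosetwise hH hS hG hHmeas hSmeas hφm, ?_, ?_⟩,
    isCofinitelyEquivariant_cosetwise hH hS hG hSfin hφc, cosetwise hH hS ψ,
    ⟨measurable_totalMap_cosetwise hH hS hG hHmeas hSmeas hψm, hleft, hright⟩,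
    isCofinitelyEquivariant_cosetwise hH hS hG hSfin hψc⟩
  -- Injectivity holds on the conull set where the cosetwise ψ is a left inverse.
  · refine ⟨_, hleft, fun y hy z hz hyz => ?_⟩
    rw [← hy, ← hz, hyz]
  · filter_upwards [hX.ae_forall_costar (ae_wideUnit_of_ae_comap hH hφmap)] with x hx
    exact fiberMeasure_map_cosetwise hH hS
      (hG.subgroupoid hH hHmeas |>.measurable_of_totalMap hφm) hx
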